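/- **The language.** Types are $A ::= \mathbb 1\mid A\oplus A\mid A\otimes A\mid \mu X.A\mid X$; put $\mathtt{nat}=\mu X.\,\mathbb 1\oplus X$ and $[A]=\mu X.\,\mathbb 1\oplus(A\otimes X)$. Values are $v ::= ()\mid x\mid \mathrm{inl}\,v\mid \mathrm{inr}\,v\mid (v,v)\mid \mathrm{fold}\,v$; patterns $p ::= x\mid (p,p)$; expressions $e ::= v\mid \mathtt{let}\ p=\omega\,p'\ \mathtt{in}\ e$; isos $\omega ::= \{v_1\leftrightarrow e_1\mid\dots\mid v_n\leftrightarrow e_n\}\mid \mathtt{fix}\,\phi.\omega\mid\lambda\phi.\omega\mid\phi\mid\omega\,\omega$; terms $t ::= ()\mid x\mid \mathrm{inl}\,t\mid\mathrm{inr}\,t\mid(t,t)\mid\mathrm{fold}\,t\mid\omega\,t\mid \mathtt{let}\ p=t\ \mathtt{in}\ t$. Tuples $(t_1,\dots,t_k)$ are right-nested pairs. Write $[\,]=0=\mathrm{fold}(\mathrm{inl}())$, $h::t=\mathrm{fold}(\mathrm{inr}(h,t))$, $S\,n=\mathrm{fold}(\mathrm{inr}\,n)$, $\mathtt{tt}=\mathrm{inl}()$,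 $\mathtt{ff}=\mathrm{inr}()$. Evaluation $\to$ is generated by $\mathtt{fix}\,\phi.\omega\to\omega[\mathtt{fix}\,\phi.\omega/\phi]$ and $(\lambda\phi.\omega_1)\omega_2\to\omega_1[\omega_2/\phi]$ (under the contexts $[\cdot]\,\omega$ and $[\cdot]\,t$), $\{v_i\leftrightarrow e_i\}_i\,v'\to\sigma(e_i)$ if $\sigma$ matches $v_i$ with the value $v'$, $\mathtt{let}\ p=v\ \mathtt{in}\ t\to\sigma(t)$ if $\sigma$ matches $p$ with the value $v$, and the contexts $\mathrm{inl}[\cdot]$, $\mathrm{inr}[\cdot]$, $\mathrm{fold}[\cdot]$, $([\cdot],v)$, $(v,[\cdot])$, $\{v_i\leftrightarrow e_i\}_i\,[\cdot]$, $\mathtt{let}\ p=[\cdot]\ \mathtt{in}\ t$; $\to^*$ is its reflexive transitive closure. The inverse $\omega^{-1}$ commutes with $\mathtt{fix}$, $\lambda$ and application, fixes iso variables, and turns each clause $v\leftrightarrow \mathtt{let}\ p_1=\omega_1p_1'\ \mathtt{in}\cdots\mathtt{let}\ p_k=\omega_kp_k'\ \mathtt{in}\ v'$ into $v'\leftrightarrow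 \mathtt{let}\ p_k'=\omega_k^{-1}p_k\ \mathtt{in}\cdots\mathtt{let}\ p_1'=\omega_1^{-1}p_1\ \mathtt{in}\ v$. **Auxiliary isos.** Below, successive equations after $\leftrightarrow$ separated by semicolons are nested lets, followed by the result. $\mathrm{Dup}_A:A\leftrightarrow A\otimes A$ is defined by recursion on $A$: $\mathrm{Dup}_{\mathbb 1}=\{()\leftrightarrow((),())\}$; $\mathrm{Dup}_{A\otimes B}=\{(x,y)\leftrightarrow (x_1,x_2)=\mathrm{Dup}_A x;\ (y_1,y_2)=\mathrm{Dup}_B y;\ ((x_1,y_1),(x_2,y_2))\}$; $\mathrm{Dup}_{A\oplus B}$ has the two clauses $\mathrm{inl}\,x\leftrightarrow (x_1,x_2)=\mathrm{Dup}_Ax;\ (\mathrm{inl}\,x_1,\mathrm{inl}\,x_2)$ and likewise for $\mathrm{inr}$ and $B$; $\mathrm{Dup}_{\mu X.A}=\mathtt{fix}\,\phi_X.\{\mathrm{fold}\,x\leftrightarrow (x_1,x_2)=\mathrm{Dup}_Ax;\ (\mathrm{fold}\,x_1,\mathrm{fold}\,x_2)\}$, where $\mathrm{Dup}_X=\{x\leftrightarrow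 (x_1,x_2)=\phi_X x;\ (x_1,x_2)\}$. For a closed value $v$, $\mathrm{erase}_v=\{(x,v)\leftrightarrow x\}$. Further, for a type $A$ and a closed value $b$ of type $A$: - $\mathrm{len}=\mathtt{fix}\,\phi.\{[\,]\leftrightarrow([\,],0)\mid h::t\leftrightarrow (t',n)=\phi\,t;\ (h::t',S n)\}$; - $\mathrm{snoc}'=\mathtt{fix}\,\phi.\{([\,],x,0)\leftrightarrow (x_1,x_2)=\mathrm{Dup}_A x;\ ([x_1],x_2,0)\mid (h::t,x,Sn)\leftrightarrow (t',x',n')=\phi(t,x,n);\ (h::t',x',Sn')\}$; - $\mathrm{snoc}=\{(x,y)\leftrightarrow (x',n)=\mathrm{len}\,x;\ (x'',y',n')=\mathrm{snoc}'(x',y,n);\ n''=\{k\leftrightarrow Sk\}\,n';\ z=\mathrm{len}^{-1}(x'',n'');\ (z,y')\}$; - $\mathrm{growth}=\{(l,r)\leftrightarrow (l_1,c_1)=\mathrm{erase}_b^{-1}l;\ (l_2,b_1)=\mathrm{snoc}(l_1,c_1);\ (r_1,c_2)=\mathrm{erase}_b^{-1}r;\ (r_2,b_2)=\mathrm{snoc}(r_1,c_2);\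 l_3=\mathrm{erase}_b(l_2,b_1);\ r_3=\mathrm{erase}_b(r_2,b_2);\ (l_3,r_3)\}$, which adds $b$ at the end of both lists; - $\mathrm{rmBlank}=\mathtt{fix}\,\phi.\{[\,]\leftrightarrow([\,],0)\mid b::t\leftrightarrow (t',n)=\phi\,t;\ (t',Sn)\mid a::t\leftrightarrow(a::t,0)\ \text{for each symbol value } a\ne b\}$; - $\mathrm{rev}_{\mathrm{aux}}=\mathtt{fix}\,\phi.\{([\,],y)\leftrightarrow([\,],y)\mid (h::t,y)\leftrightarrow (h_1,h_2)=\mathrm{Dup}_Ah;\ w=\{(h,y)\leftrightarrow h::y\}(h_2,y);\ (t_1,t_2)=\phi(t,w);\ (h_1::t_1,t_2)\}$ and $\mathrm{rev}=\{x\leftrightarrow (x_1,x_2)=\mathrm{erase}_{[\,]}^{-1}x;\ (t_1,t_2)=\mathrm{rev}_{\mathrm{aux}}(x_1,x_2);\ (t_1,t_2)\}$, sending a list to itself and its reversal; - $\mathrm{It}=\lambda\psi.\,\mathtt{fix}\,\phi.\{x\leftrightarrow y=\psi\,x;\ z=(\omega_{\mathrm{aux}}\,\phi)\,y;\ z\}$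 with $\omega_{\mathrm{aux}}=\lambda\psi'.\{(y,\mathtt{tt})\leftrightarrow (z,n)=\psi'y;\ (z,Sn)\mid (y,\mathtt{ff})\leftrightarrow(y,0)\}$. For $\omega:A\leftrightarrow B\otimes C$ and $\omega':B\leftrightarrow A\otimes C'$ let $$\mathrm{GarRem}(\omega,\omega')=\{x_1\leftrightarrow (x_2,y)=\omega\,x_1;\ (x_3,z)=\mathrm{Dup}_Bx_2;\ x_4=\omega^{-1}(x_3,y);\ (z_2,y_2)=\omega' z;\ z_3=\mathrm{Dup}_B^{-1}(z_2,x_4);\ z_4=\omega'^{-1}(z_3,y_2);\ z_4\}.$$ **Machines.** A reversible Turing machine (RTM) $M=(Q,\Sigma,\delta,b,q_s,q_f)$ has finite sets $Q$ of states and $\Sigma\ni b$ of symbols, and a relation $\delta\subseteq Q\times[(\Sigma\times\Sigma)\cup\{\leftarrow,\downarrow,\rightarrow\}]\times Q$ with no transition out of $q_f$ or into $q_s$. It is forward deterministic: two distinct transitions with the same source are write transitions $(s_1,s_1')$, $(s_2,s_2')$ with $s_1\neq s_2$; and backward deterministic: two distinct transitions with the same target are write transitions with $s_1'\ne s_2'$.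 A configuration $(q,(l,s,r))$ consists of a state, the string $l$ left of the head, the scanned symbol $s$ and the string $r$ right of it; the empty string $\epsilon$ stands for infinitely many blanks, so configurations are identified when they differ only by blanks at the outer ends of $l$ and $r$. In one step $C\rightsquigarrow C'$, a transition $(q,(s,s'),q')$ replaces the scanned symbol $s$ by $s'$, and $\leftarrow,\downarrow,\rightarrow$ move the head one cell to the left, not at all, one cell to the right. $M^{-1}$ has the transitions $(q',(s',s),q)$ for $(q,(s,s'),q')\in\delta$ and $(q',a^{-1},q)$ for moves $(q,a,q')\in\delta$, where $\leftarrow^{-1}=\rightarrow$, $\rightarrow^{-1}=\leftarrow$, $\downarrow^{-1}=\downarrow$; its start state is $q_f$ and its final state $q_s$. **Encoding.** Fix enumerations of $Q$ and $\Sigma$; the $i$-th element of an $n$-element set is encoded as the $i$-th closed value $x^T$ of $\mathbb 1\oplus(\mathbb 1\oplus\cdots)$ ($n$ summands). With $C^T=Q^T\otimes([\Sigma^T]\otimes\Sigma^T\otimes[\Sigma^T])$, let $\mathrm{isos}(q,(a_1\cdots a_k,s,a_1'\cdots a_m'))=(q^T,([a_k^T,\dots,a_1^T],s^T,[a_1'^T,\dots,a_m'^T]))$.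 All isos above are used with $A=\Sigma^T$ and the blank $b^T$. The iso $\mathrm{isos}_{\mathbb B}(M)$ has one clause for each transition $(q,a,q')$, where $\beta=\mathtt{ff}$ if $q'$ is the final state of $M$ and $\beta=\mathtt{tt}$ otherwise: - $a={\rightarrow}$: $(q^T,(x,z,y::x'))\leftrightarrow (l,r)=\mathrm{growth}(x,x');\ ((q'^T,(z::l,y,r)),\beta)$; - $a={\leftarrow}$: $(q^T,(y::x,z,x'))\leftrightarrow (l,r)=\mathrm{growth}(x,x');\ ((q'^T,(l,y,z::r)),\beta)$; - $a={\downarrow}$: $(q^T,(x,z,x'))\leftrightarrow (l,r)=\mathrm{growth}(x,x');\ ((q'^T,(l,z,r)),\beta)$; - $a=(s,s')$: $(q^T,(x,s^T,x'))\leftrightarrow (l,r)=\mathrm{growth}(x,x');\ ((q'^T,(l,s'^T,r)),\beta)$. Let $\mathrm{cleanUp}=\{((x,(l,y,r)),n)\leftrightarrow (l',n_1)=\mathrm{rmBlank}\,l;\ (r_1,r_2)=\mathrm{rev}\,r;\ (r_3,n_2)=\mathrm{rmBlank}\,r_2;\ (r_4,r')=\mathrm{rev}\,r_3;\ ((x,(l',y,r')),(n,n_1,n_2,r_1,r_4))\}$,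 which removes the outer blanks of the tape, and $\mathrm{pad}=\{(x,(l,y,r))\leftrightarrow (l',r')=\mathrm{growth}(l,r);\ (x,(l',y,r'))\}$. With $\omega_2\circ\omega_1=\{x\leftrightarrow y=\omega_1x;\ z=\omega_2y;\ z\}$, put $$\Omega_M=\mathrm{cleanUp}\circ \mathrm{It}(\mathrm{isos}_{\mathbb B}(M)),\qquad \Omega_M^{+}=\Omega_M\circ\mathrm{pad}.$$ **Theorem.** Let $M$ be an RTM with $q_s\ne q_f$, let $s,s'\in(\Sigma\setminus\{b\})^*$, $C=(q_s,(\epsilon,b,s))$, $C'=(q_f,(\epsilon,b,s'))$, and suppose $M\vdash C\rightsquigarrow^* C'$. Then $$\mathrm{GarRem}(\Omega_M^{+},\Omega_{M^{-1}}^{+})\ \mathrm{isos}(C)\ \to^*\ \mathrm{isos}(C').$$ If moreover the first moves of $M$ on $s$ and of $M^{-1}$ on $s'$ do not leave the given finite strings (that is, no transition $(q_s,\leftarrow,q)$ and no transition $(q,\rightarrow,q_f)$ is in $\delta$; if some $(q_s,\rightarrow,q)\in\delta$ then $s\ne\epsilon$; and if some $(q,\leftarrow,q_f)\in\delta$ then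 $s'\neq\epsilon$), then also without the initial padding $$\mathrm{GarRem}(\Omega_M,\Omega_{M^{-1}})\ \mathrm{isos}(C)\ \to^*\ \mathrm{isos}(C').$$ -/

import Mathlib

namespace RevLang

/-! ## The reversible language: types, isos and terms -/

/-- Base types.  Type variables are de Bruijn indices, `mu` binds index `0`. -/
inductive Ty : Type
  | one : Ty
  | sum : Ty → Ty → Ty
  | prod : Ty → Ty → Ty
  | mu : Ty → Ty
  | var : ℕ → Ty

/-- Values.  Term variables are named by natural numbers. -/
inductive Val : Type
  | unit : Val
  | var : ℕ → Val
  | inl : Val → Val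
  | inr : Val → Val
  | pair : Val → Val → Val
  | fold : Val → Val

/-- Patterns: variables and pairs of patterns. -/
inductive Pat : Type
  | var : ℕ → Pat
  | pair : Pat → Pat → Pat

mutual
/-- Isos.  Iso variables are de Bruijn indices (so isos are taken up to renaming of bound iso
variables); `fix` and `lam` bind index `0`. -/
inductive Iso : Type
  | clauses : Clauses → Iso
  | fix : Iso → Iso
  | lam : Iso → Iso
  | var : ℕ → Iso
  | app : Iso → Iso → Iso
/-- Finite families of clauses `v ↔ e`. -/
inductive Clauses : Type
  | nil : Clauses
  | cons : Val → Expr → Clauses → Clauses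
/-- Expressions: a value, or `let p = ω p' in e`. -/
inductive Expr : Type
  | val : Val → Expr
  | letIn : Pat → Iso → Pat → Expr → Expr
end

/-- Terms. -/
inductive Term : Type
  | unit : Term
  | var : ℕ → Term
  | inl : Term → Term
  | inr : Term → Term
  | pair : Term → Term → Term
  | fold : Term → Term
  | app : Iso → Term → Term
  | letIn : Pat → Term → Term → Term

def Pat.toVal : Pat → Val
  | .var x => .var x
  | .pair p q => .pair p.toVal q.toVal

/-- The variables of a pattern. -/
def Pat.vars : Pat → List ℕ
  | .var x => [x]
  | .pair p q => p.vars ++ q.vars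

def Val.toTerm : Val → Term
  | .unit => .unit
  | .var x => .var x
  | .inl v => .inl v.toTerm
  | .inr v => .inr v.toTerm
  | .pair v w => .pair v.toTerm w.toTerm
  | .fold v => .fold v.toTerm

def Expr.toTerm : Expr → Term
  | .val v => v.toTerm
  | .letIn p ω q e => .letIn p (.app ω q.toVal.toTerm) e.toTerm

def Clauses.ofList : List (Val × Expr) → Clauses
  | [] => .nil
  | c :: cs => .cons c.1 c.2 (Clauses.ofList cs)

/-- `cs.Mem v e`: the clause `v ↔ e` is one of the clauses `cs`. -/
inductive Clauses.Mem : Clauses → Val → Expr → Prop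
  | head (v : Val) (e : Expr) (cs : Clauses) : Clauses.Mem (.cons v e cs) v e
  | tail (v w : Val) (e f : Expr) (cs : Clauses) :
      Clauses.Mem cs v e → Clauses.Mem (.cons w f cs) v e

/-- The iso `{v₁ ↔ e₁ | … | vₙ ↔ eₙ}`. -/
def Iso.ofList (cs : List (Val × Expr)) : Iso := .clauses (Clauses.ofList cs)

/-! ## Substitution of iso variables -/

mutual
/-- Increase by one every free iso variable with index at least `c`. -/
def Iso.shift (c : ℕ) : Iso → Iso
  | .clauses cs => .clauses (Clauses.shift c cs)
  | .fix ω => .fix (Iso.shift (c + 1) ω)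
  | .lam ω => .lam (Iso.shift (c + 1) ω)
  | .var i => .var (if i < c then i else i + 1)
  | .app ω₁ ω₂ => .app (Iso.shift c ω₁) (Iso.shift c ω₂)
def Clauses.shift (c : ℕ) : Clauses → Clauses
  | .nil => .nil
  | .cons v e cs => .cons v (Expr.shift c e) (Clauses.shift c cs)
def Expr.shift (c : ℕ) : Expr → Expr
  | .val v => .val v
  | .letIn p ω q e => .letIn p (Iso.shift c ω) q (Expr.shift c e)
end

mutual
/-- `Iso.subst k α ω` is `ω[α/k]`: replace the iso variable `k` of `ω` by `α` and remove it from
the context. -/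
def Iso.subst (k : ℕ) (α : Iso) : Iso → Iso
  | .clauses cs => .clauses (Clauses.subst k α cs)
  | .fix ω => .fix (Iso.subst (k + 1) (α.shift 0) ω)
  | .lam ω => .lam (Iso.subst (k + 1) (α.shift 0) ω)
  | .var i => if i = k then α else .var (if k < i then i - 1 else i)
  | .app ω₁ ω₂ => .app (Iso.subst k α ω₁) (Iso.subst k α ω₂)
def Clauses.subst (k : ℕ) (α : Iso) : Clauses → Clauses
  | .nil => .nil
  | .cons v e cs => .cons v (Expr.subst k α e) (Clauses.subst k α cs)
def Expr.subst (k : ℕ) (α : Iso) : Expr → Expr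
  | .val v => .val v
  | .letIn p ω q e => .letIn p (Iso.subst k α ω) q (Expr.subst k α e)
end

/-! ## Operational semantics -/

/-- Substitutions of values for term variables, as finite maps. -/
abbrev Subst : Type := List (ℕ × Val)

/-- `σ(t)`.  Variables bound by a `let` are not replaced in its body. -/
def Term.subst (σ : Subst) : Term → Term
  | .unit => .unit
  | .var x => ((σ.lookup x).map Val.toTerm).getD (.var x)
  | .inl t => .inl (t.subst σ)
  | .inr t => .inr (t.subst σ)
  | .pair t u => .pair (t.subst σ) (u.subst σ)
  | .fold t => .fold (t.subst σ)
  | .app ω t => .app ω (t.subst σ)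
  | .letIn p t u => .letIn p (t.subst σ) (u.subst (σ.filter fun a => a.1 ∉ p.vars))

/-- Pattern matching: `Match σ v v'` is `σ[v] = v'`. -/
inductive Match : Subst → Val → Val → Prop
  | unit : Match [] .unit .unit
  | var (x : ℕ) (v : Val) : Match [(x, v)] (.var x) v
  | inl {σ : Subst} {v w : Val} : Match σ v w → Match σ (.inl v) (.inl w)
  | inr {σ : Subst} {v w : Val} : Match σ v w → Match σ (.inr v) (.inr w)
  | fold {σ : Subst} {v w : Val} : Match σ v w → Match σ (.fold v) (.fold w)
  | pair {σ₁ σ₂ : Subst} {v₁ v₂ w₁ w₂ : Val} : Match σ₁ v₁ w₁ → Match σ₂ v₂ w₂ →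
      (σ₁.map Prod.fst).Disjoint (σ₂.map Prod.fst) →
      Match (σ₁ ++ σ₂) (.pair v₁ v₂) (.pair w₁ w₂)

/-- Evaluation of isos. -/
inductive Iso.Step : Iso → Iso → Prop
  | fix (ω : Iso) : Iso.Step (.fix ω) (Iso.subst 0 (.fix ω) ω)
  | beta (ω₁ ω₂ : Iso) : Iso.Step (.app (.lam ω₁) ω₂) (Iso.subst 0 ω₂ ω₁)
  | app {ω₁ ω₁' : Iso} (ω₂ : Iso) : Iso.Step ω₁ ω₁' → Iso.Step (.app ω₁ ω₂) (.app ω₁' ω₂)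

/-- Evaluation of terms: a call-by-value strategy on terms. -/
inductive Term.Step : Term → Term → Prop
  | iso {ω ω' : Iso} (t : Term) : Iso.Step ω ω' → Term.Step (.app ω t) (.app ω' t)
  | clause {cs : Clauses} {v v' : Val} {e : Expr} {σ : Subst} :
      cs.Mem v e → Match σ v v' →
      Term.Step (.app (.clauses cs) v'.toTerm) (e.toTerm.subst σ)
  | letVal {p : Pat} {v : Val} {σ : Subst} (t : Term) : Match σ p.toVal v →
      Term.Step (.letIn p v.toTerm t) (t.subst σ)
  | inl {t t' : Term} : Term.Step t t' → Term.Step (.inl t) (.inl t')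
  | inr {t t' : Term} : Term.Step t t' → Term.Step (.inr t) (.inr t')
  | fold {t t' : Term} : Term.Step t t' → Term.Step (.fold t) (.fold t')
  | pairLeft {t t' : Term} (v : Val) : Term.Step t t' →
      Term.Step (.pair t v.toTerm) (.pair t' v.toTerm)
  | pairRight {t t' : Term} (v : Val) : Term.Step t t' →
      Term.Step (.pair v.toTerm t) (.pair v.toTerm t')
  | appArg {t t' : Term} (cs : Clauses) : Term.Step t t' →
      Term.Step (.app (.clauses cs) t) (.app (.clauses cs) t')
  | letArg {t t' : Term} (p : Pat) (u : Term) : Term.Step t t' →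
      Term.Step (.letIn p t u) (.letIn p t' u)

/-- The reflexive transitive closure `→*` of evaluation. -/
def Term.Reduces : Term → Term → Prop := Relation.ReflTransGen Term.Step

/-! ## Inversion -/

/-- The value at the end of an expression. -/
def Expr.result : Expr → Val
  | .val v => v
  | .letIn _ _ _ e => e.result

mutual
/-- The inverse iso.  A clause `v ↔ let p₁ = ω₁ p₁' in … let pₙ = ωₙ pₙ' in v'` becomes
`v' ↔ let pₙ' = ωₙ⁻¹ pₙ in … let p₁' = ω₁⁻¹ p₁ in v`. -/
def Iso.inv : Iso → Iso
  | .clauses cs => .clauses (Clauses.inv cs)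
  | .fix ω => .fix (Iso.inv ω)
  | .lam ω => .lam (Iso.inv ω)
  | .var i => .var i
  | .app ω₁ ω₂ => .app (Iso.inv ω₁) (Iso.inv ω₂)
def Clauses.inv : Clauses → Clauses
  | .nil => .nil
  | .cons v e cs => .cons e.result (Expr.invOnto e (.val v)) (Clauses.inv cs)
/-- Put the inverted `let`s of the first expression, in reverse order, in front of the second. -/
def Expr.invOnto : Expr → Expr → Expr
  | .val _, acc => acc
  | .letIn p ω q e, acc => Expr.invOnto e (.letIn q (Iso.inv ω) p acc)
end

/-! ## Data -/

namespace Val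
def nil : Val := .fold (.inl .unit)
def cons (h t : Val) : Val := .fold (.inr (.pair h t))
def zero : Val := .fold (.inl .unit)
def succ (v : Val) : Val := .fold (.inr v)
def tt : Val := .inl .unit
def ff : Val := .inr .unit
def ofList : List Val → Val
  | [] => nil
  | v :: vs => cons v (ofList vs)
end Val

/-- `1 ⊕ (1 ⊕ (⋯ ⊕ 1))` with `n` summands (for `n ≥ 1`). -/
def Ty.fin : ℕ → Ty
  | n + 2 => .sum .one (Ty.fin (n + 1))
  | _ => .one

/-- The `i`-th closed value of type `Ty.fin n`, for `i < n`. -/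
def Val.fin : ℕ → ℕ → Val
  | n + 2, i + 1 => .inr (Val.fin (n + 1) i)
  | _ + 2, 0 => .inl .unit
  | _, _ => .unit

/-- The type `[A] = μ X. 1 ⊕ (A ⊗ X)` of lists over a closed type `A`. -/
def Ty.list (A : Ty) : Ty := .mu (.sum .one (.prod A (.var 0)))

/-! ## Duplication, constants and list isos

In the definitions below the numerals name the term variables of a clause. -/

/-- Duplication `A ↔ A ⊗ A`.  The iso variable attached to a type variable of `A` is the one bound
by the `fix` introduced at the corresponding `μ`, hence carries the same de Bruijn index. -/
def dup : Ty → Iso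
  | .one => .ofList [(.unit, .val (.pair .unit .unit))]
  | .prod A B => .ofList [
      (.pair (.var 0) (.var 1),
        .letIn (.pair (.var 2) (.var 3)) (dup A) (.var 0) <|
        .letIn (.pair (.var 4) (.var 5)) (dup B) (.var 1) <|
        .val (.pair (.pair (.var 2) (.var 4)) (.pair (.var 3) (.var 5))))]
  | .sum A B => .ofList [
      (.inl (.var 0),
        .letIn (.pair (.var 1) (.var 2)) (dup A) (.var 0) <|
        .val (.pair (.inl (.var 1)) (.inl (.var 2)))),
      (.inr (.var 0),
        .letIn (.pair (.var 1) (.var 2)) (dup B) (.var 0) <|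
        .val (.pair (.inr (.var 1)) (.inr (.var 2))))]
  | .mu A => .fix <| .ofList [
      (.fold (.var 0),
        .letIn (.pair (.var 1) (.var 2)) (dup A) (.var 0) <|
        .val (.pair (.fold (.var 1)) (.fold (.var 2))))]
  | .var i => .ofList [
      (.var 0,
        .letIn (.pair (.var 1) (.var 2)) (.var i) (.var 0) <|
        .val (.pair (.var 1) (.var 2)))]

/-- `erase_v = {(x, v) ↔ x}` for a closed value `v`; its inverse `{x ↔ (x, v)}` introduces `v`. -/
def erase (v : Val) : Iso := .ofList [(.pair (.var 0) v, .val (.var 0))]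

/-- `{n ↔ S n}`. -/
def succIso : Iso := .ofList [(.var 0, .val (.succ (.var 0)))]

/-- `{(h, t) ↔ h :: t}`. -/
def consIso : Iso := .ofList [(.pair (.var 0) (.var 1), .val (.cons (.var 0) (.var 1)))]

/-- `[A] ↔ [A] ⊗ nat`, pairing a list with its length. -/
def len : Iso := .fix <| .ofList [
  (.nil, .val (.pair .nil .zero)),
  (.cons (.var 0) (.var 1),
    .letIn (.pair (.var 2) (.var 3)) (.var 0) (.var 1) <|
    .val (.pair (.cons (.var 0) (.var 2)) (.succ (.var 3))))]

/-- `[A] ⊗ A ⊗ nat ↔ [A] ⊗ A ⊗ nat`. -/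
def snocAux (A : Ty) : Iso := .fix <| .ofList [
  (.pair .nil (.pair (.var 0) .zero),
    .letIn (.pair (.var 1) (.var 2)) (dup A) (.var 0) <|
    .val (.pair (.cons (.var 1) .nil) (.pair (.var 2) .zero))),
  (.pair (.cons (.var 0) (.var 1)) (.pair (.var 2) (.succ (.var 3))),
    .letIn (.pair (.var 4) (.pair (.var 5) (.var 6))) (.var 0)
      (.pair (.var 1) (.pair (.var 2) (.var 3))) <|
    .val (.pair (.cons (.var 0) (.var 4)) (.pair (.var 5) (.succ (.var 6)))))]

/-- `[A] ⊗ A ↔ [A] ⊗ A`, sending `([a₁, …, aₙ], a)` to `([a₁, …, aₙ, a], a)`. -/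
def snoc (A : Ty) : Iso := .ofList [
  (.pair (.var 0) (.var 1),
    .letIn (.pair (.var 2) (.var 3)) len (.var 0) <|
    .letIn (.pair (.var 4) (.pair (.var 5) (.var 6))) (snocAux A)
      (.pair (.var 2) (.pair (.var 1) (.var 3))) <|
    .letIn (.var 7) succIso (.var 6) <|
    .letIn (.var 8) len.inv (.pair (.var 4) (.var 7)) <|
    .val (.pair (.var 8) (.var 5)))]

/-- `[A] ⊗ [A] ↔ [A] ⊗ [A]`, adding the constant `b` of type `A` at the end of both lists. -/
def growth (A : Ty) (b : Val) : Iso := .ofList [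
  (.pair (.var 0) (.var 1),
    .letIn (.pair (.var 2) (.var 3)) (erase b).inv (.var 0) <|
    .letIn (.pair (.var 4) (.var 5)) (snoc A) (.pair (.var 2) (.var 3)) <|
    .letIn (.pair (.var 6) (.var 7)) (erase b).inv (.var 1) <|
    .letIn (.pair (.var 8) (.var 9)) (snoc A) (.pair (.var 6) (.var 7)) <|
    .letIn (.var 10) (erase b) (.pair (.var 4) (.var 5)) <|
    .letIn (.var 11) (erase b) (.pair (.var 8) (.var 9)) <|
    .val (.pair (.var 10) (.var 11)))]

/-- `[A] ⊗ [A] ↔ [A] ⊗ [A]`, the accumulator version of list reversal. -/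
def revAux (A : Ty) : Iso := .fix <| .ofList [
  (.pair .nil (.var 0), .val (.pair .nil (.var 0))),
  (.pair (.cons (.var 0) (.var 1)) (.var 2),
    .letIn (.pair (.var 3) (.var 4)) (dup A) (.var 0) <|
    .letIn (.var 5) consIso (.pair (.var 4) (.var 2)) <|
    .letIn (.pair (.var 6) (.var 7)) (.var 0) (.pair (.var 1) (.var 5)) <|
    .val (.pair (.cons (.var 3) (.var 6)) (.var 7)))]

/-- `[A] ↔ [A] ⊗ [A]`, pairing a list with its reversal. -/
def rev (A : Ty) : Iso := .ofList [
  (.var 0,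
    .letIn (.pair (.var 1) (.var 2)) (erase .nil).inv (.var 0) <|
    .letIn (.pair (.var 3) (.var 4)) (revAux A) (.pair (.var 1) (.var 2)) <|
    .val (.pair (.var 3) (.var 4)))]

/-- `[A] ↔ [A] ⊗ nat`, removing and counting the `b`s at the beginning of a list; `as` lists the
symbols other than `b`. -/
def rmBlank (b : Val) (as : List Val) : Iso := .fix <| .ofList <|
  (.nil, .val (.pair .nil .zero)) ::
  (.cons b (.var 0),
    .letIn (.pair (.var 1) (.var 2)) (.var 0) (.var 0) <|
    .val (.pair (.var 1) (.succ (.var 2)))) ::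
  as.map fun a => (.cons a (.var 0), .val (.pair (.cons a (.var 0)) .zero))

/-! ## Iteration, composition and garbage removal -/

/-- `λψ'. {(y, tt) ↔ let (z, n) = ψ' y in (z, S n) | (y, ff) ↔ (y, 0)}`. -/
def itAux : Iso := .lam <| .ofList [
  (.pair (.var 0) .tt,
    .letIn (.pair (.var 1) (.var 2)) (.var 0) (.var 0) <|
    .val (.pair (.var 1) (.succ (.var 2)))),
  (.pair (.var 0) .ff, .val (.pair (.var 0) .zero))]

/-- `It = λψ. fix φ. {x ↔ let y = ψ x in let z = (itAux φ) y in z}`. -/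
def it : Iso := .lam <| .fix <| .ofList [
  (.var 0,
    .letIn (.var 1) (.var 1) (.var 0) <|
    .letIn (.var 2) (.app itAux (.var 0)) (.var 1) <|
    .val (.var 2))]

/-- `{x ↔ let y = ω₁ x in let z = ω₂ y in z}`, for closed isos: first `ω₁`, then `ω₂`. -/
def Iso.andThen (ω₁ ω₂ : Iso) : Iso := .ofList [
  (.var 0,
    .letIn (.var 1) ω₁ (.var 0) <|
    .letIn (.var 2) ω₂ (.var 1) <|
    .val (.var 2))]

/-- Garbage removal `A ↔ B` from closed isos `ω : A ↔ B ⊗ C` and `ω' : B ↔ A ⊗ C'`: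
`{x₁ ↔ let (x₂, y) = ω x₁ in let (x₃, z) = dup x₂ in let x₄ = ω⁻¹ (x₃, y) in
let (z₂, y₂) = ω' z in let z₃ = dup⁻¹ (z₂, x₄) in let z₄ = ω'⁻¹ (z₃, y₂) in z₄}`. -/
def garRem (B : Ty) (ω ω' : Iso) : Iso := .ofList [
  (.var 0,
    .letIn (.pair (.var 1) (.var 2)) ω (.var 0) <|
    .letIn (.pair (.var 3) (.var 4)) (dup B) (.var 1) <|
    .letIn (.var 5) ω.inv (.pair (.var 3) (.var 2)) <|
    .letIn (.pair (.var 6) (.var 7)) ω' (.var 4) <|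
    .letIn (.var 8) (dup B).inv (.pair (.var 6) (.var 5)) <|
    .letIn (.var 9) ω'.inv (.pair (.var 8) (.var 7)) <|
    .val (.var 9))]

/-! ## Reversible Turing machines -/

/-- What a transition does: overwrite `s` by `s'`, or move the head. -/
inductive Action (Γ : Type*) : Type _
  | write : Γ → Γ → Action Γ
  | left : Action Γ
  | stay : Action Γ
  | right : Action Γ

/-- Turing machines in triple format; they may be nondeterministic. -/
structure TM (Q Γ : Type*) where
  δ : Finset (Q × Action Γ × Q)
  blank : Γ
  start : Q
  final : Q
  not_from_final : ∀ q a q', (q, a, q') ∈ δ → q ≠ final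
  not_to_start : ∀ q a q', (q, a, q') ∈ δ → q' ≠ start

/-- Forward and backward determinism. -/
structure TM.Reversible {Q Γ : Type*} (M : TM Q Γ) : Prop where
  forward : ∀ q₁ a₁ q₁' q₂ a₂ q₂', (q₁, a₁, q₁') ∈ M.δ → (q₂, a₂, q₂') ∈ M.δ →
    (q₁, a₁, q₁') ≠ (q₂, a₂, q₂') → q₁ = q₂ →
    ∃ s₁ s₁' s₂ s₂', a₁ = .write s₁ s₁' ∧ a₂ = .write s₂ s₂' ∧ s₁ ≠ s₂
  backward : ∀ q₁ a₁ q₁' q₂ a₂ q₂', (q₁, a₁, q₁') ∈ M.δ → (q₂, a₂, q₂') ∈ M.δ →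
    (q₁, a₁, q₁') ≠ (q₂, a₂, q₂') → q₁' = q₂' →
    ∃ s₁ s₁' s₂ s₂', a₁ = .write s₁ s₁' ∧ a₂ = .write s₂ s₂' ∧ s₁' ≠ s₂'

def Action.inv {Γ : Type*} : Action Γ → Action Γ
  | .write s s' => .write s' s
  | .left => .right
  | .stay => .stay
  | .right => .left

theorem Action.inv_inv {Γ : Type*} (a : Action Γ) : a.inv.inv = a := by
  cases a <;> rfl

/-- The inverse of a transition. -/
def invTransition {Q Γ : Type*} : (Q × Action Γ × Q) ↪ (Q × Action Γ × Q) where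
  toFun t := (t.2.2, t.2.1.inv, t.1)
  inj' := by
    rintro ⟨q₁, a₁, q₁'⟩ ⟨q₂, a₂, q₂'⟩ h
    simp only [Prod.mk.injEq] at h
    obtain ⟨h₁, h₂, h₃⟩ := h
    rw [h₁, h₃, ← Action.inv_inv a₁, h₂, Action.inv_inv]

/-- The inverse machine: all transitions inverted, start and final states exchanged. -/
def TM.inv {Q Γ : Type*} (M : TM Q Γ) : TM Q Γ where
  δ := M.δ.map invTransition
  blank := M.blank
  start := M.final
  final := M.start
  not_from_final := by
    intro q a q' h
    obtain ⟨⟨p, c, p'⟩, hp, e⟩ := Finset.mem_map.1 h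
    have h₁ : p' = q := congrArg Prod.fst e
    exact h₁ ▸ M.not_to_start p c p' hp
  not_to_start := by
    intro q a q' h
    obtain ⟨⟨p, c, p'⟩, hp, e⟩ := Finset.mem_map.1 h
    have h₁ : p = q' := congrArg (fun t => t.2.2) e
    exact h₁ ▸ M.not_from_final p c p' hp

/-- Configurations `(q, (l, s, r))`.  The strings `l` and `r` are written from left to right, so the
head is next to the last symbol of `l` and to the first symbol of `r`. -/
structure Config (Q Γ : Type*) where
  state : Q
  left : List Γ
  head : Γ
  right : List Γ

/-- The standard configuration `(q, (ε, b, s))`. -/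
def Config.standard {Q Γ : Type*} (b : Γ) (q : Q) (s : List Γ) : Config Q Γ := ⟨q, [], b, s⟩

/-- Two configurations are the same up to blanks at the outer ends of the tape: the empty string
stands for an infinite sequence of blanks. -/
def Config.BlankEquiv {Q Γ : Type*} (b : Γ) (C D : Config Q Γ) : Prop :=
  C.state = D.state ∧ C.head = D.head ∧
  (∃ i j, List.replicate i b ++ C.left = List.replicate j b ++ D.left) ∧
  (∃ i j, C.right ++ List.replicate i b = D.right ++ List.replicate j b)

/-- One transition on a finite representation of a configuration. -/
inductive TM.RawStep {Q Γ : Type*} (M : TM Q Γ) : Config Q Γ → Config Q Γ → Prop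
  | write {q q' : Q} {s s' : Γ} (l r : List Γ) : (q, .write s s', q') ∈ M.δ →
      TM.RawStep M ⟨q, l, s, r⟩ ⟨q', l, s', r⟩
  | left {q q' : Q} (l : List Γ) (x s : Γ) (r : List Γ) : (q, .left, q') ∈ M.δ →
      TM.RawStep M ⟨q, l ++ [x], s, r⟩ ⟨q', l, x, s :: r⟩
  | stay {q q' : Q} (l : List Γ) (s : Γ) (r : List Γ) : (q, .stay, q') ∈ M.δ →
      TM.RawStep M ⟨q, l, s, r⟩ ⟨q', l, s, r⟩
  | right {q q' : Q} (l : List Γ) (s x : Γ) (r : List Γ) : (q, .right, q') ∈ M.δ →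
      TM.RawStep M ⟨q, l, s, x :: r⟩ ⟨q', l ++ [s], x, r⟩

/-- `M ⊢ C ⇝ C'`. -/
def TM.Step {Q Γ : Type*} (M : TM Q Γ) (C C' : Config Q Γ) : Prop :=
  ∃ D D', C.BlankEquiv M.blank D ∧ M.RawStep D D' ∧ D'.BlankEquiv M.blank C'

/-- `M ⊢ C ⇝* C'`. -/
def TM.Reaches {Q Γ : Type*} (M : TM Q Γ) : Config Q Γ → Config Q Γ → Prop :=
  Relation.ReflTransGen M.Step

/-- No transition out of the start state moves the head off the finite strings `ε`, `s` of the
standard configuration `(start, (ε, b, s))`: there is no move to the left, and a move to the right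
only if `s` is not empty. -/
def TM.StartsWithin {Q Γ : Type*} (M : TM Q Γ) (s : List Γ) : Prop :=
  ∀ q, (M.start, .left, q) ∉ M.δ ∧ ((M.start, .right, q) ∈ M.δ → s ≠ [])

/-! ## Encoding machines as isos

The states and the tape symbols are enumerated by `eQ : Q ≃ Fin n` and `eΓ : Γ ≃ Fin m`. -/

section Encoding

variable {Q Γ : Type*} {n m : ℕ}

/-- The closed value encoding an element of an enumerated set. -/
def enc {α : Type*} {k : ℕ} (e : α ≃ Fin k) (a : α) : Val := Val.fin k (e a)

/-- The type `Q^T ⊗ ([Σ^T] ⊗ Σ^T ⊗ [Σ^T])` of configurations, for `n` states and `m` symbols. -/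
def confTy (n m : ℕ) : Ty :=
  .prod (Ty.fin n) (.prod (Ty.list (Ty.fin m)) (.prod (Ty.fin m) (Ty.list (Ty.fin m))))

/-- The closed value encoding a configuration; the left part of the tape is reversed. -/
def isosConf (eQ : Q ≃ Fin n) (eΓ : Γ ≃ Fin m) (C : Config Q Γ) : Val :=
  .pair (enc eQ C.state) (.pair (Val.ofList (C.left.reverse.map (enc eΓ)))
    (.pair (enc eΓ C.head) (Val.ofList (C.right.map (enc eΓ)))))

/-- The left-hand side of the clause of a transition, on the variables `0` (left), `1` (head),
`2` (right), `3` (symbol next to the head). -/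
def transLhs (eQ : Q ≃ Fin n) (eΓ : Γ ≃ Fin m) (q : Q) : Action Γ → Val
  | .right => .pair (enc eQ q) (.pair (.var 0) (.pair (.var 1) (.cons (.var 3) (.var 2))))
  | .left => .pair (enc eQ q) (.pair (.cons (.var 3) (.var 0)) (.pair (.var 1) (.var 2)))
  | .stay => .pair (enc eQ q) (.pair (.var 0) (.pair (.var 1) (.var 2)))
  | .write s _ => .pair (enc eQ q) (.pair (.var 0) (.pair (enc eΓ s) (.var 2)))

/-- The configuration on the right-hand side, where `4` and `5` are the grown left and right
parts of the tape. -/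
def transRhs (eQ : Q ≃ Fin n) (eΓ : Γ ≃ Fin m) (q' : Q) : Action Γ → Val
  | .right => .pair (enc eQ q') (.pair (.cons (.var 1) (.var 4)) (.pair (.var 3) (.var 5)))
  | .left => .pair (enc eQ q') (.pair (.var 4) (.pair (.var 3) (.cons (.var 1) (.var 5))))
  | .stay => .pair (enc eQ q') (.pair (.var 4) (.pair (.var 1) (.var 5)))
  | .write _ s' => .pair (enc eQ q') (.pair (.var 4) (.pair (enc eΓ s') (.var 5)))

open Classical in
/-- The clause of a transition `(q, a, q')`; the boolean is `ff` if `q'` is the final state `qf`,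
and `tt` otherwise. -/
noncomputable def transClause (eQ : Q ≃ Fin n) (eΓ : Γ ≃ Fin m) (b : Γ) (qf : Q)
    (t : Q × Action Γ × Q) : Val × Expr :=
  (transLhs eQ eΓ t.1 t.2.1,
    .letIn (.pair (.var 4) (.var 5)) (growth (Ty.fin m) (enc eΓ b)) (.pair (.var 0) (.var 2)) <|
    .val (.pair (transRhs eQ eΓ t.2.2 t.2.1) (if t.2.2 = qf then .ff else .tt)))

/-- `isos_𝔹(M) : C^T ↔ C^T ⊗ (1 ⊕ 1)`, with one clause for each transition of `M`. -/
noncomputable def isosB (eQ : Q ≃ Fin n) (eΓ : Γ ≃ Fin m) (M : TM Q Γ) : Iso :=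
  .ofList (M.δ.toList.map (transClause eQ eΓ M.blank M.final))

/-- `rmBlank` on the tape alphabet with blank `b`. -/
def rmBlankTape (eΓ : Γ ≃ Fin m) (b : Γ) : Iso :=
  rmBlank (enc eΓ b) (((List.finRange m).filter (· ≠ eΓ b)).map fun i => Val.fin m i)

/-- `C^T ⊗ nat ↔ C^T ⊗ (nat ⊗ nat ⊗ nat ⊗ [Σ^T] ⊗ [Σ^T])`, removing the blanks at the outer ends of
the tape: `((x, (l, y, r)), k) ↔ let (l', n₁) = rmBlank l in let (r₁, r₂) = rev r in
let (r₃, n₂) = rmBlank r₂ in let (r₄, r') = rev r₃ in ((x, (l', y, r')), (k, n₁, n₂, r₁, r₄))`. -/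
def cleanUp (eΓ : Γ ≃ Fin m) (b : Γ) : Iso := .ofList [
  (.pair (.pair (.var 0) (.pair (.var 1) (.pair (.var 2) (.var 3)))) (.var 4),
    .letIn (.pair (.var 5) (.var 6)) (rmBlankTape eΓ b) (.var 1) <|
    .letIn (.pair (.var 7) (.var 8)) (rev (Ty.fin m)) (.var 3) <|
    .letIn (.pair (.var 9) (.var 10)) (rmBlankTape eΓ b) (.var 8) <|
    .letIn (.pair (.var 11) (.var 12)) (rev (Ty.fin m)) (.var 9) <|
    .val (.pair (.pair (.var 0) (.pair (.var 5) (.pair (.var 2) (.var 12))))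
      (.pair (.var 4) (.pair (.var 6) (.pair (.var 10) (.pair (.var 7) (.var 11)))))))]

/-- `{(x, (l, y, r)) ↔ let (l', r') = growth (l, r) in (x, (l', y, r'))}`. -/
def pad (eΓ : Γ ≃ Fin m) (b : Γ) : Iso := .ofList [
  (.pair (.var 0) (.pair (.var 1) (.pair (.var 2) (.var 3))),
    .letIn (.pair (.var 4) (.var 5)) (growth (Ty.fin m) (enc eΓ b)) (.pair (.var 1) (.var 3)) <|
    .val (.pair (.var 0) (.pair (.var 4) (.pair (.var 2) (.var 5)))))]

/-- `cleanUp (It (isos_𝔹(M)))`. -/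
noncomputable def run (eQ : Q ≃ Fin n) (eΓ : Γ ≃ Fin m) (M : TM Q Γ) : Iso :=
  (Iso.app it (isosB eQ eΓ M)).andThen (cleanUp eΓ M.blank)

/-- `cleanUp (It (isos_𝔹(M)))` preceded by one growth of both ends of the tape. -/
noncomputable def paddedRun (eQ : Q ≃ Fin n) (eΓ : Γ ≃ Fin m) (M : TM Q Γ) : Iso :=
  (pad eΓ M.blank).andThen (run eQ eΓ M)

end Encoding

end RevLang

open RevLang

/-!
Evaluation of an iso is replaced by a big-step relation `Iso.Eval` on closed values. A clause is
evaluated by guessing a single environment for all its variables, such that every binding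
`p = ω q` relates the values of `q` and `p`; nothing in this description distinguishes input from
output. Hence `Iso.Eval.inv`: if `ω` relates `v` to `w`, then `ω⁻¹` relates `w` to `v`. On isos all of
whose clauses are well scoped in both directions, a property stable under inversion and under
substitution, the relation is sound for the operational semantics (`Iso.Eval.reduces`), because the
substitutions produced by pattern matching are all restrictions of the guessed environment.

It remains to evaluate the isos that make up the encoding. One pass through `isos_𝔹(M)` makes a
step of `M` and adds a blank at both ends of the tape (`eval_isosB`), so that after the first step,
or after the initial padding, every move stays on the written part of the tape and the iteration
follows the run of `M` (`eval_itLoop`). The final clean-up removes the blanks that have accumulated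
(`eval_cleanUp`), which recovers the standard final configuration since its string has no blanks.
The inverse machine runs from the final to the initial configuration (`TM.Reaches.inv`), so the same
facts apply to it. Garbage removal then combines both evaluations and their inverses
(`eval_garRem`): the first computation is undone after copying its output, and the copy of the input
left over is absorbed by the inverted computation of the inverse machine.
-/

namespace RevLang

/-! ### Closed values and environments -/

/-- Closed values. -/
inductive CVal : Type
  | unit : CVal
  | inl : CVal → CVal
  | inr : CVal → CVal
  | pair : CVal → CVal → CVal
  | fold : CVal → CVal

def CVal.toVal : CVal → Val
  | .unit => .unit
  | .inl v => .inl v.toVal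
  | .inr v => .inr v.toVal
  | .pair v w => .pair v.toVal w.toVal
  | .fold v => .fold v.toVal

/-- The value of an open value in an environment of closed values. -/
def Val.eval (ρ : ℕ → CVal) : Val → CVal
  | .unit => .unit
  | .var x => ρ x
  | .inl v => .inl (v.eval ρ)
  | .inr v => .inr (v.eval ρ)
  | .pair v w => .pair (v.eval ρ) (w.eval ρ)
  | .fold v => .fold (v.eval ρ)

/-- The variables of a value, from left to right and with repetitions. -/
def Val.vars : Val → List ℕ
  | .unit => []
  | .var x => [x]
  | .inl v => v.vars
  | .inr v => v.vars
  | .pair v w => v.vars ++ w.vars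
  | .fold v => v.vars

@[simp] theorem CVal.eval_toVal (ρ : ℕ → CVal) (v : CVal) : v.toVal.eval ρ = v := by
  induction v <;> simp_all [CVal.toVal, Val.eval]

@[simp] theorem CVal.vars_toVal (v : CVal) : v.toVal.vars = [] := by
  induction v <;> simp_all [CVal.toVal, Val.vars]

@[simp] theorem CVal.subst_toVal (σ : Subst) (v : CVal) :
    v.toVal.toTerm.subst σ = v.toVal.toTerm := by
  induction v <;> simp_all [CVal.toVal, Val.toTerm, Term.subst]

@[simp] theorem Pat.vars_toVal (p : Pat) : p.toVal.vars = p.vars := by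
  induction p <;> simp_all [Pat.toVal, Pat.vars, Val.vars]

/-- The finite substitution that an environment induces on a list of variables. -/
def restrict (ρ : ℕ → CVal) (l : List ℕ) : Subst := l.map fun x => (x, (ρ x).toVal)

theorem lookup_restrict (ρ : ℕ → CVal) (l : List ℕ) (x : ℕ) :
    (restrict ρ l).lookup x = if x ∈ l then some (ρ x).toVal else none := by
  induction l with
  | nil => rfl
  | cons y l ih =>
    simp only [restrict, List.map_cons, List.lookup_cons] at ih ⊢
    by_cases h : x = y
    · subst h; simp
    · have : (x == y) = false := by simpa using h
      simp [this, ih, h]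

theorem filter_restrict (ρ : ℕ → CVal) (l : List ℕ) (p : Pat) :
    (restrict ρ l).filter (fun a => a.1 ∉ p.vars) = restrict ρ (l.filter fun x => x ∉ p.vars) := by
  simp [restrict, List.filter_map, Function.comp_def]

theorem map_fst_restrict (ρ : ℕ → CVal) (l : List ℕ) : (restrict ρ l).map Prod.fst = l := by
  simp [restrict, Function.comp_def]

theorem match_eval (ρ : ℕ → CVal) (v : Val) (h : v.vars.Nodup) :
    Match (restrict ρ v.vars) v (v.eval ρ).toVal := by
  induction v with
  | unit => exact .unit
  | var x => exact .var x _
  | inl v ih => exact .inl (ih h)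
  | inr v ih => exact .inr (ih h)
  | fold v ih => exact .fold (ih h)
  | pair v w ihv ihw =>
    obtain ⟨hv, hw, hd⟩ := List.nodup_append'.1 h
    have := Match.pair (ihv hv) (ihw hw) (by simpa only [map_fst_restrict] using hd)
    simpa [restrict, Val.vars, Val.eval, CVal.toVal] using this

theorem subst_eq_eval (ρ : ℕ → CVal) (l : List ℕ) (v : Val) (h : v.vars ⊆ l) :
    v.toTerm.subst (restrict ρ l) = (v.eval ρ).toVal.toTerm := by
  induction v with
  | unit => rfl
  | var x =>
    have : x ∈ l := h (by simp [Val.vars])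
    simp [Val.toTerm, Term.subst, lookup_restrict, this, Val.eval]
  | pair v w ihv ihw =>
    obtain ⟨hv, hw⟩ := List.append_subset.1 h
    simp [Val.toTerm, Term.subst, Val.eval, CVal.toVal, ihv hv, ihw hw]
  | _ v ih =>
    have := ih h
    simp [Val.toTerm, Term.subst, Val.eval, CVal.toVal, this]

theorem subst_subst_restrict (ρ : ℕ → CVal) (t : Term) (l k : List ℕ) :
    (t.subst (restrict ρ l)).subst (restrict ρ k) = t.subst (restrict ρ (l ++ k)) := by
  induction t generalizing l k with
  | var x =>
    by_cases hl : x ∈ l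
    · simp [Term.subst, lookup_restrict, hl]
    · simp [Term.subst, lookup_restrict, hl]
  | letIn p t u iht ihu =>
    simp only [Term.subst, filter_restrict, iht, ihu, List.filter_append]
  | _ => simp_all [Term.subst]

/-! ### Let-bindings, and inversion -/

/-- The bindings `p = ω q` of an expression, outermost first. -/
def Expr.lets : Expr → List (Pat × Iso × Pat)
  | .val _ => []
  | .letIn p ω q e => (p, ω, q) :: e.lets

/-- The pairs of patterns `p`, `q` of the bindings `p = ω q`. -/
def Expr.skel : Expr → List (Pat × Pat)
  | .val _ => []
  | .letIn p _ q e => (p, q) :: e.skel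

theorem Expr.result_invOnto : ∀ e acc : Expr, (e.invOnto acc).result = acc.result
  | .val _, acc => by simp [Expr.invOnto]
  | .letIn p ω q e, acc => by
    rw [Expr.invOnto, Expr.result_invOnto e, Expr.result]

theorem Expr.lets_invOnto : ∀ e acc : Expr, (e.invOnto acc).lets =
    (e.lets.map fun l => (l.2.2, l.2.1.inv, l.1)).reverse ++ acc.lets
  | .val _, acc => by simp [Expr.invOnto, Expr.lets]
  | .letIn p ω q e, acc => by
    rw [Expr.invOnto, Expr.lets_invOnto e]; simp [Expr.lets]

theorem Expr.skel_invOnto : ∀ e acc : Expr, (e.invOnto acc).skel =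
    (e.skel.map Prod.swap).reverse ++ acc.skel
  | .val _, acc => by simp [Expr.invOnto, Expr.skel]
  | .letIn p ω q e, acc => by
    rw [Expr.invOnto, Expr.skel_invOnto e]; simp [Expr.skel]

@[simp] theorem Expr.result_subst (k : ℕ) (α : Iso) :
    ∀ e : Expr, (e.subst k α).result = e.result
  | .val _ => by simp [Expr.subst]
  | .letIn p ω q e => by simp [Expr.subst, Expr.result, Expr.result_subst k α e]

@[simp] theorem Expr.skel_subst (k : ℕ) (α : Iso) : ∀ e : Expr, (e.subst k α).skel = e.skel
  | .val _ => by simp [Expr.subst]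
  | .letIn p ω q e => by simp [Expr.subst, Expr.skel, Expr.skel_subst k α e]

@[simp] theorem Expr.result_shift (c : ℕ) : ∀ e : Expr, (e.shift c).result = e.result
  | .val _ => by simp [Expr.shift]
  | .letIn p ω q e => by simp [Expr.shift, Expr.result, Expr.result_shift c e]

@[simp] theorem Expr.skel_shift (c : ℕ) : ∀ e : Expr, (e.shift c).skel = e.skel
  | .val _ => by simp [Expr.shift]
  | .letIn p ω q e => by simp [Expr.shift, Expr.skel, Expr.skel_shift c e]

mutual
theorem Iso.inv_shift : ∀ (c : ℕ) (ω : Iso), (ω.shift c).inv = ω.inv.shift c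
  | c, .clauses cs => by simp [Iso.shift, Iso.inv, Clauses.inv_shift c cs]
  | c, .fix ω => by simp [Iso.shift, Iso.inv, Iso.inv_shift (c + 1) ω]
  | c, .lam ω => by simp [Iso.shift, Iso.inv, Iso.inv_shift (c + 1) ω]
  | c, .var i => by simp [Iso.shift, Iso.inv]
  | c, .app ω₁ ω₂ => by simp [Iso.shift, Iso.inv, Iso.inv_shift c ω₁, Iso.inv_shift c ω₂]
theorem Clauses.inv_shift : ∀ (c : ℕ) (cs : Clauses), (cs.shift c).inv = cs.inv.shift c
  | c, .nil => by simp [Clauses.shift, Clauses.inv]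
  | c, .cons v e cs => by
    simp [Clauses.shift, Clauses.inv, Clauses.inv_shift c cs, Expr.invOnto_shift c e, Expr.shift]
theorem Expr.invOnto_shift : ∀ (c : ℕ) (e acc : Expr),
    (e.invOnto acc).shift c = (e.shift c).invOnto (acc.shift c)
  | c, .val _, acc => by simp [Expr.shift, Expr.invOnto]
  | c, .letIn p ω q e, acc => by
    simp [Expr.shift, Expr.invOnto, Expr.invOnto_shift c e, Iso.inv_shift c ω]
end

mutual
theorem Iso.inv_subst : ∀ (k : ℕ) (α ω : Iso), (Iso.subst k α ω).inv = Iso.subst k α.inv ω.inv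
  | k, α, .clauses cs => by simp [Iso.subst, Iso.inv, Clauses.inv_subst k α cs]
  | k, α, .fix ω => by simp [Iso.subst, Iso.inv, Iso.inv_subst (k + 1) _ ω, Iso.inv_shift]
  | k, α, .lam ω => by simp [Iso.subst, Iso.inv, Iso.inv_subst (k + 1) _ ω, Iso.inv_shift]
  | k, α, .var i => by simp only [Iso.subst, Iso.inv]; split <;> simp [Iso.inv]
  | k, α, .app ω₁ ω₂ => by simp [Iso.subst, Iso.inv, Iso.inv_subst k α ω₁, Iso.inv_subst k α ω₂]
theorem Clauses.inv_subst : ∀ (k : ℕ) (α : Iso) (cs : Clauses),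
    (cs.subst k α).inv = cs.inv.subst k α.inv
  | k, α, .nil => by simp [Clauses.subst, Clauses.inv]
  | k, α, .cons v e cs => by
    simp [Clauses.subst, Clauses.inv, Clauses.inv_subst k α cs, Expr.invOnto_subst k α e,
      Expr.subst]
theorem Expr.invOnto_subst : ∀ (k : ℕ) (α : Iso) (e acc : Expr),
    (e.invOnto acc).subst k α.inv = (e.subst k α).invOnto (acc.subst k α.inv)
  | k, α, .val _, acc => by simp [Expr.subst, Expr.invOnto]
  | k, α, .letIn p ω q e, acc => by
    simp [Expr.subst, Expr.invOnto, Expr.invOnto_subst k α e, Iso.inv_subst k α ω]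
end

mutual
theorem Iso.subst_shift : ∀ (c : ℕ) (α ω : Iso), Iso.subst c α (ω.shift c) = ω
  | c, α, .clauses cs => by simp [Iso.shift, Iso.subst, Clauses.subst_shift c α cs]
  | c, α, .fix ω => by simp [Iso.shift, Iso.subst, Iso.subst_shift (c + 1) _ ω]
  | c, α, .lam ω => by simp [Iso.shift, Iso.subst, Iso.subst_shift (c + 1) _ ω]
  | c, α, .var i => by
    simp only [Iso.shift, Iso.subst]
    split_ifs <;> first | omega | simp
  | c, α, .app ω₁ ω₂ => by
    simp [Iso.shift, Iso.subst, Iso.subst_shift c α ω₁, Iso.subst_shift c α ω₂]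
theorem Clauses.subst_shift : ∀ (c : ℕ) (α : Iso) (cs : Clauses), (cs.shift c).subst c α = cs
  | c, α, .nil => by simp [Clauses.shift, Clauses.subst]
  | c, α, .cons v e cs => by
    simp [Clauses.shift, Clauses.subst, Clauses.subst_shift c α cs, Expr.subst_shift c α e]
theorem Expr.subst_shift : ∀ (c : ℕ) (α : Iso) (e : Expr), (e.shift c).subst c α = e
  | c, α, .val _ => by simp [Expr.shift, Expr.subst]
  | c, α, .letIn p ω q e => by
    simp [Expr.shift, Expr.subst, Expr.subst_shift c α e, Iso.subst_shift c α ω]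
end

theorem Iso.Step.inv {ω ω' : Iso} (h : Iso.Step ω ω') : Iso.Step ω.inv ω'.inv := by
  induction h with
  | fix ω => rw [Iso.inv_subst]; simpa only [Iso.inv] using Iso.Step.fix ω.inv
  | beta ω₁ ω₂ => rw [Iso.inv_subst]; simpa only [Iso.inv] using Iso.Step.beta ω₁.inv ω₂.inv
  | app ω₂ _ ih => simpa only [Iso.inv] using Iso.Step.app ω₂.inv ih

theorem Clauses.Mem.inv {cs : Clauses} {v : Val} {e : Expr} (h : cs.Mem v e) :
    cs.inv.Mem e.result (e.invOnto (.val v)) := by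
  induction h with
  | head v e cs => rw [Clauses.inv]; exact .head _ _ _
  | tail v w e f cs _ ih => rw [Clauses.inv]; exact .tail _ _ _ _ _ ih

/-! ### The symmetric evaluation relation -/

/-- Big-step evaluation of isos.  A clause is evaluated by guessing one environment `ρ` for all its
variables, in which every binding `p = ω q` has to hold; so both directions of a clause have the
same evaluations. -/
inductive Iso.Eval : Iso → CVal → CVal → Prop
  | step {ω ω' : Iso} {v w : CVal} : Iso.Step ω ω' → Iso.Eval ω' v w → Iso.Eval ω v w
  | clause {cs : Clauses} {v : Val} {e : Expr} (ρ : ℕ → CVal) : cs.Mem v e →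
      (∀ l ∈ e.lets, Iso.Eval l.2.1 (l.2.2.toVal.eval ρ) (l.1.toVal.eval ρ)) →
      Iso.Eval (.clauses cs) (v.eval ρ) (e.result.eval ρ)

/-- Evaluations can be run backwards: the environment that witnesses a clause also witnesses the
inverse clause. -/
theorem Iso.Eval.inv {ω : Iso} {v w : CVal} (h : ω.Eval v w) : ω.inv.Eval w v := by
  induction h with
  | step hs _ ih => exact .step hs.inv ih
  | @clause cs v e ρ hm _ ih =>
    have := Iso.Eval.clause (cs := cs.inv) ρ hm.inv (by
      intro l hl
      simp only [Expr.lets_invOnto, Expr.lets, List.append_nil, List.mem_reverse,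
        List.mem_map] at hl
      obtain ⟨l, hl, rfl⟩ := hl
      exact ih l hl)
    rwa [Expr.result_invOnto] at this

/-! ### Well-scoped isos -/

/-- Starting with the variables `ctx`, the bindings with the patterns `ls` use only variables that
are already bound, bind no variable twice at once, and finally bind the variables of `w`. -/
def Scoped : List ℕ → List (Pat × Pat) → Val → Prop
  | ctx, [], w => w.vars ⊆ ctx
  | ctx, (p, q) :: ls, w => q.vars ⊆ ctx ∧ p.vars.Nodup ∧ Scoped (p.vars ++ ctx) ls w

/-- A clause from `v` to `w` through bindings with the patterns `ls` is well scoped, and so is its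
inverse. -/
def BiScoped (v : Val) (ls : List (Pat × Pat)) (w : Val) : Prop :=
  v.vars.Nodup ∧ w.vars.Nodup ∧ Scoped v.vars ls w ∧ Scoped w.vars (ls.map Prod.swap).reverse v

theorem BiScoped.symm {v w : Val} {ls : List (Pat × Pat)} (h : BiScoped v ls w) :
    BiScoped w (ls.map Prod.swap).reverse v :=
  ⟨h.2.1, h.1, h.2.2.2, by simpa [List.map_reverse] using h.2.2.1⟩

mutual
/-- All clauses that occur in an iso, also within nested isos, are well scoped in both
directions. -/
def Iso.WF : Iso → Prop
  | .clauses cs => cs.WF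
  | .fix ω => ω.WF
  | .lam ω => ω.WF
  | .var _ => True
  | .app ω₁ ω₂ => ω₁.WF ∧ ω₂.WF
def Clauses.WF : Clauses → Prop
  | .nil => True
  | .cons v e cs => BiScoped v e.skel e.result ∧ e.WF ∧ cs.WF
def Expr.WF : Expr → Prop
  | .val _ => True
  | .letIn _ ω _ e => ω.WF ∧ e.WF
end

mutual
theorem Iso.WF.inv : ∀ {ω : Iso}, ω.WF → ω.inv.WF
  | .clauses cs, h => by simp only [Iso.inv, Iso.WF] at h ⊢; exact Clauses.WF.inv h
  | .fix ω, h => by simp only [Iso.inv, Iso.WF] at h ⊢; exact Iso.WF.inv h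
  | .lam ω, h => by simp only [Iso.inv, Iso.WF] at h ⊢; exact Iso.WF.inv h
  | .var _, h => by simp only [Iso.inv, Iso.WF]
  | .app ω₁ ω₂, h => by
    simp only [Iso.inv, Iso.WF] at h ⊢; exact ⟨Iso.WF.inv h.1, Iso.WF.inv h.2⟩
theorem Clauses.WF.inv : ∀ {cs : Clauses}, cs.WF → cs.inv.WF
  | .nil, _ => by simp only [Clauses.inv, Clauses.WF]
  | .cons v e cs, h => by
    simp only [Clauses.inv, Clauses.WF] at h ⊢
    refine ⟨?_, Expr.WF.invOnto h.2.1 (by simp only [Expr.WF]), Clauses.WF.inv h.2.2⟩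
    simpa only [Expr.skel_invOnto, Expr.result_invOnto, Expr.skel, Expr.result,
      List.append_nil] using h.1.symm
theorem Expr.WF.invOnto : ∀ {e acc : Expr}, e.WF → acc.WF → (e.invOnto acc).WF
  | .val _, _, _, h => by simpa only [Expr.invOnto] using h
  | .letIn p ω q e, acc, h, h' => by
    simp only [Expr.invOnto]
    simp only [Expr.WF] at h
    exact Expr.WF.invOnto h.2 (by simp only [Expr.WF]; exact ⟨Iso.WF.inv h.1, h'⟩)
end

mutual
theorem Iso.WF.shift : ∀ {ω : Iso} (c : ℕ), ω.WF → (ω.shift c).WF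
  | .clauses cs, c, h => by simp only [Iso.shift, Iso.WF] at h ⊢; exact Clauses.WF.shift c h
  | .fix ω, c, h => by simp only [Iso.shift, Iso.WF] at h ⊢; exact Iso.WF.shift _ h
  | .lam ω, c, h => by simp only [Iso.shift, Iso.WF] at h ⊢; exact Iso.WF.shift _ h
  | .var _, c, h => by simp only [Iso.shift, Iso.WF]
  | .app ω₁ ω₂, c, h => by
    simp only [Iso.shift, Iso.WF] at h ⊢; exact ⟨Iso.WF.shift c h.1, Iso.WF.shift c h.2⟩
theorem Clauses.WF.shift : ∀ {cs : Clauses} (c : ℕ), cs.WF → (cs.shift c).WF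
  | .nil, _, _ => by simp only [Clauses.shift, Clauses.WF]
  | .cons v e cs, c, h => by
    simp only [Clauses.shift, Clauses.WF, Expr.skel_shift, Expr.result_shift] at h ⊢
    exact ⟨h.1, Expr.WF.shift c h.2.1, Clauses.WF.shift c h.2.2⟩
theorem Expr.WF.shift : ∀ {e : Expr} (c : ℕ), e.WF → (e.shift c).WF
  | .val _, _, _ => by simp only [Expr.shift, Expr.WF]
  | .letIn p ω q e, c, h => by
    simp only [Expr.shift, Expr.WF] at h ⊢; exact ⟨Iso.WF.shift c h.1, Expr.WF.shift c h.2⟩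
end

mutual
theorem Iso.WF.subst : ∀ {ω α : Iso} (k : ℕ), ω.WF → α.WF → (Iso.subst k α ω).WF
  | .clauses cs, α, k, h, hα => by
    simp only [Iso.subst, Iso.WF] at h ⊢; exact Clauses.WF.subst k h hα
  | .fix ω, α, k, h, hα => by
    simp only [Iso.subst, Iso.WF] at h ⊢; exact Iso.WF.subst _ h (hα.shift 0)
  | .lam ω, α, k, h, hα => by
    simp only [Iso.subst, Iso.WF] at h ⊢; exact Iso.WF.subst _ h (hα.shift 0)
  | .var _, α, k, h, hα => by
    simp only [Iso.subst]
    split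
    · exact hα
    · simp only [Iso.WF]
  | .app ω₁ ω₂, α, k, h, hα => by
    simp only [Iso.subst, Iso.WF] at h ⊢
    exact ⟨Iso.WF.subst k h.1 hα, Iso.WF.subst k h.2 hα⟩
theorem Clauses.WF.subst : ∀ {cs : Clauses} {α : Iso} (k : ℕ), cs.WF → α.WF → (cs.subst k α).WF
  | .nil, _, _, _, _ => by simp only [Clauses.subst, Clauses.WF]
  | .cons v e cs, α, k, h, hα => by
    simp only [Clauses.subst, Clauses.WF, Expr.skel_subst, Expr.result_subst] at h ⊢
    exact ⟨h.1, Expr.WF.subst k h.2.1 hα, Clauses.WF.subst k h.2.2 hα⟩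
theorem Expr.WF.subst : ∀ {e : Expr} {α : Iso} (k : ℕ), e.WF → α.WF → (e.subst k α).WF
  | .val _, _, _, _, _ => by simp only [Expr.subst, Expr.WF]
  | .letIn p ω q e, α, k, h, hα => by
    simp only [Expr.subst, Expr.WF] at h ⊢
    exact ⟨Iso.WF.subst k h.1 hα, Expr.WF.subst k h.2 hα⟩
end

theorem Iso.WF.step {ω ω' : Iso} (h : ω.WF) (hs : Iso.Step ω ω') : ω'.WF := by
  induction hs with
  | fix ω => exact Iso.WF.subst 0 (by simpa only [Iso.WF] using h) h
  | beta ω₁ ω₂ =>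
    simp only [Iso.WF] at h
    exact Iso.WF.subst 0 h.1 h.2
  | app ω₂ _ ih =>
    simp only [Iso.WF] at h ⊢
    exact ⟨ih h.1, h.2⟩

theorem Clauses.WF.mem {cs : Clauses} {v : Val} {e : Expr} (h : cs.WF) (hm : cs.Mem v e) :
    BiScoped v e.skel e.result ∧ e.WF := by
  induction hm with
  | head v e cs => simp only [Clauses.WF] at h; exact ⟨h.1, h.2.1⟩
  | tail v w e f cs _ ih => simp only [Clauses.WF] at h; exact ih h.2.2

theorem Expr.WF.lets : ∀ {e : Expr}, e.WF → ∀ l ∈ e.lets, l.2.1.WF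
  | .val _, _, l, hl => by simp [Expr.lets] at hl
  | .letIn p ω q e, h, l, hl => by
    rw [Expr.WF] at h
    rw [Expr.lets, List.mem_cons] at hl
    rcases hl with rfl | hl
    · exact h.1
    · exact Expr.WF.lets h.2 l hl

/-! ### Soundness of the evaluation relation -/

/-- Evaluation of an expression, given that the isos of its bindings reduce as they should.  The
substitution may be defined on more variables than those of the scope. -/
theorem Expr.reduces (ρ : ℕ → CVal) : ∀ (e : Expr) (ctx ctx' : List ℕ),
    Scoped ctx e.skel e.result → ctx ⊆ ctx' →
    (∀ l ∈ e.lets, Term.Reduces (.app l.2.1 (l.2.2.toVal.eval ρ).toVal.toTerm)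
      (l.1.toVal.eval ρ).toVal.toTerm) →
    Term.Reduces (e.toTerm.subst (restrict ρ ctx')) (e.result.eval ρ).toVal.toTerm
  | .val v, ctx, ctx', hs, hc, _ => by
    rw [Expr.toTerm, subst_eq_eval ρ ctx' v (List.Subset.trans hs hc)]
    exact .refl
  | .letIn p ω q e, ctx, ctx', hs, hc, hl => by
    obtain ⟨hq, hp, hs⟩ := hs
    rw [Expr.toTerm, Term.subst, Term.subst, filter_restrict,
      subst_eq_eval ρ ctx' q.toVal (by rw [Pat.vars_toVal]; exact List.Subset.trans hq hc)]
    refine Relation.ReflTransGen.trans (Relation.ReflTransGen.lift (Term.letIn p · _)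
      (fun _ _ h => Term.Step.letArg p _ h) _ _ (hl (p, ω, q) (by simp [Expr.lets]))) ?_
    have hm := match_eval ρ p.toVal (by rwa [Pat.vars_toVal])
    refine Relation.ReflTransGen.head (Term.Step.letVal _ hm) ?_
    rw [subst_subst_restrict, Expr.result]
    refine Expr.reduces ρ e _ _ hs ?_ fun l h => hl l (by simp [Expr.lets, h])
    intro x hx
    by_cases h : x ∈ p.vars
    · simp [h]
    · have : x ∈ ctx' := hc (by simpa [h] using hx)
      simp [h, this]

theorem Iso.Eval.reduces {ω : Iso} {v w : CVal} (h : ω.Eval v w) (hω : ω.WF) :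
    Term.Reduces (.app ω v.toVal.toTerm) w.toVal.toTerm := by
  induction h with
  | step hs _ ih => exact .head (.iso _ hs) (ih (hω.step hs))
  | @clause cs v e ρ hm _ ih =>
    rw [Iso.WF] at hω
    obtain ⟨hb, he⟩ := hω.mem hm
    refine .head (.clause hm (match_eval ρ v hb.1)) ?_
    refine Expr.reduces ρ e _ _ hb.2.2.1 (List.Subset.refl _) fun l hl => ih l hl (he.lets l hl)

/-! ### Closed data -/

namespace CVal
/-- Closed values for lists, natural numbers and booleans, matching the constructions of the same
names on `Val`. -/
def nil : CVal := .fold (.inl .unit)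
def cons (h t : CVal) : CVal := .fold (.inr (.pair h t))
def zero : CVal := .fold (.inl .unit)
def succ (v : CVal) : CVal := .fold (.inr v)
def tt : CVal := .inl .unit
def ff : CVal := .inr .unit
def ofList : List CVal → CVal
  | [] => nil
  | v :: vs => cons v (ofList vs)
/-- The numeral of a natural number. -/
def nat : ℕ → CVal
  | 0 => zero
  | n + 1 => succ (nat n)
/-- The closed value `Val.fin n i`. -/
def fin : ℕ → ℕ → CVal
  | n + 2, i + 1 => .inr (fin (n + 1) i)
  | _ + 2, 0 => .inl .unit
  | _, _ => .unit
end CVal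

theorem CVal.toVal_ofList (l : List CVal) : (ofList l).toVal = Val.ofList (l.map toVal) := by
  induction l with
  | nil => rfl
  | cons a l ih => simp [ofList, cons, Val.ofList, Val.cons, toVal, ih]

theorem CVal.toVal_fin (n i : ℕ) : (fin n i).toVal = Val.fin n i := by
  induction n using Nat.strong_induction_on generalizing i with
  | _ n ih =>
    match n, i with
    | n + 2, i + 1 => simp [fin, Val.fin, toVal, ih (n + 1) (by omega)]
    | n + 2, 0 => simp [fin, Val.fin, toVal]
    | 0, _ => simp [fin, Val.fin, toVal]
    | 1, _ => simp [fin, Val.fin, toVal]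

/-- The environment that gives the variables `0`, `1`, … the listed values, and `()` to all others. -/
def env (l : List CVal) (x : ℕ) : CVal := l.getD x .unit

/-- The clause rule with its endpoints and bindings as separate goals, for concrete clauses. -/
theorem Iso.Eval.of_mem {cs : Clauses} {v : Val} {e : Expr} {a b : CVal} (ρ : ℕ → CVal)
    (hm : cs.Mem v e) (ha : v.eval ρ = a) (hb : e.result.eval ρ = b)
    (hl : e.lets.Forall fun l => l.2.1.Eval (l.2.2.toVal.eval ρ) (l.1.toVal.eval ρ)) :
    (Iso.clauses cs).Eval a b := by
  subst ha hb
  exact .clause ρ hm (List.forall_iff_forall_mem.1 hl)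

theorem Clauses.mem_ofList {cs : List (Val × Expr)} {c : Val × Expr} (h : c ∈ cs) :
    (Clauses.ofList cs).Mem c.1 c.2 := by
  induction cs with
  | nil => simp at h
  | cons d cs ih =>
    rcases List.mem_cons.1 h with rfl | h
    · exact .head _ _ _
    · exact .tail _ _ _ _ _ (ih h)

theorem Clauses.Mem.subst {cs : Clauses} {v : Val} {e : Expr} (h : cs.Mem v e) (k : ℕ) (α : Iso) :
    (cs.subst k α).Mem v (e.subst k α) := by
  induction h with
  | head v e cs => rw [Clauses.subst]; exact .head _ _ _
  | tail v w e f cs _ ih => rw [Clauses.subst]; exact .tail _ _ _ _ _ ih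

/-! ### Duplication -/

/-- Duplication on `A` contains no free iso variables, as is the case for closed types `A`. -/
def Ty.DupClosed (A : Ty) : Prop := ∀ k α, Iso.subst k α (dup A) = dup A

/-- Duplication on `A` does duplicate the closed value `a`. -/
def Ty.Dups (A : Ty) (a : CVal) : Prop := (dup A).Eval a (.pair a a)

theorem Ty.dupClosed_fin (n : ℕ) : (Ty.fin n).DupClosed := by
  intro k α
  induction n using Nat.strong_induction_on with
  | _ n ih =>
    match n with
    | 0 => rfl
    | 1 => rfl
    | n + 2 =>
      have := ih (n + 1) (by omega)
      simp only [Ty.fin, dup, Iso.ofList, Clauses.ofList, Iso.subst, Clauses.subst,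
        Expr.subst, this]

theorem Ty.dups_one : Ty.Dups .one .unit :=
  .of_mem (env []) (.head _ _ _) rfl rfl trivial

theorem Ty.Dups.prod {A B : Ty} {a b : CVal} (ha : A.Dups a) (hb : B.Dups b) :
    (Ty.prod A B).Dups (.pair a b) :=
  .of_mem (env [a, b, a, a, b, b]) (.head _ _ _) rfl rfl ⟨ha, hb⟩

theorem Ty.dups_fin (n i : ℕ) : (Ty.fin n).Dups (.fin n i) := by
  induction n using Nat.strong_induction_on generalizing i with
  | _ n ih =>
    match n, i with
    | n + 2, i + 1 =>
      exact .of_mem (env (List.replicate 3 (.fin (n + 1) i))) (.tail _ _ _ _ _ (.head _ _ _))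
        rfl rfl (ih (n + 1) (by omega) i)
    | n + 2, 0 => exact .of_mem (env []) (.head _ _ _) rfl rfl Ty.dups_one
    | 0, _ => exact Ty.dups_one
    | 1, _ => exact Ty.dups_one

/-- Duplication of lists. The substitution that unfolds the recursion has to leave duplication of the
entries unchanged, hence the hypothesis on `A`. -/
theorem Ty.dups_list {A : Ty} (hA : A.DupClosed) (l : List CVal) (hl : ∀ a ∈ l, A.Dups a) :
    (Ty.list A).Dups (.ofList l) := by
  induction l with
  | nil =>
    refine .step (.fix _) (.of_mem (env (List.replicate 3 (.inl .unit))) (.head _ _ _)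
      rfl rfl ?_)
    exact .of_mem (env []) (.head _ _ _) rfl rfl Ty.dups_one
  | cons a l ih =>
    have ih := ih fun b hb => hl b (by simp [hb])
    have ha := hl a (by simp)
    rw [Ty.Dups, ← hA] at ha
    refine .step (.fix _) (.of_mem (env (List.replicate 3 (.inr (.pair a (.ofList l)))))
      (.head _ _ _) rfl rfl ?_)
    refine .of_mem (env (List.replicate 3 (.pair a (.ofList l))))
      (.tail _ _ _ _ _ (.head _ _ _)) rfl rfl ?_
    refine .of_mem (env [a, .ofList l, a, a, .ofList l, .ofList l]) (.head _ _ _) rfl rfl ⟨ha, ?_⟩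
    exact .of_mem (env (List.replicate 3 (.ofList l))) (.head _ _ _) rfl rfl ih

/-! ### Lists -/

theorem eval_erase (a v : CVal) : (erase a.toVal).Eval (.pair v a) v :=
  .of_mem (env [v]) (.head _ _ _) (by simp [Val.eval, env]) rfl trivial

theorem eval_len (l : List CVal) : len.Eval (.ofList l) (.pair (.ofList l) (.nat l.length)) := by
  induction l with
  | nil => exact .step (.fix _) (.of_mem (env []) (.head _ _ _) rfl rfl trivial)
  | cons a l ih =>
    exact .step (.fix _) (.of_mem (env [a, .ofList l, .ofList l, .nat l.length])
      (.tail _ _ _ _ _ (.head _ _ _)) rfl rfl ih)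

theorem eval_snocAux {A : Ty} (hA : A.DupClosed) {a : CVal} (ha : A.Dups a) (l : List CVal) :
    (snocAux A).Eval (.pair (.ofList l) (.pair a (.nat l.length)))
      (.pair (.ofList (l ++ [a])) (.pair a (.nat l.length))) := by
  induction l with
  | nil =>
    rw [Ty.Dups, ← hA] at ha
    exact .step (.fix _) (.of_mem (env [a, a, a]) (.head _ _ _) rfl rfl ha)
  | cons x l ih =>
    exact .step (.fix _) (.of_mem
      (env [x, .ofList l, a, .nat l.length, .ofList (l ++ [a]), a, .nat l.length])
      (.tail _ _ _ _ _ (.head _ _ _)) rfl rfl ih)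

theorem eval_succIso (v : CVal) : succIso.Eval v (.succ v) :=
  .of_mem (env [v]) (.head _ _ _) rfl rfl trivial

theorem eval_consIso (h t : CVal) : consIso.Eval (.pair h t) (.cons h t) :=
  .of_mem (env [h, t]) (.head _ _ _) rfl rfl trivial

theorem eval_snoc {A : Ty} (hA : A.DupClosed) {a : CVal} (ha : A.Dups a) (l : List CVal) :
    (snoc A).Eval (.pair (.ofList l) a) (.pair (.ofList (l ++ [a])) a) := by
  have hlen := (eval_len (l ++ [a])).inv
  rw [List.length_append] at hlen
  exact .of_mem (env [.ofList l, a, .ofList l, .nat l.length, .ofList (l ++ [a]), a,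
      .nat l.length, .nat (l.length + 1), .ofList (l ++ [a])])
    (.head _ _ _) rfl rfl ⟨eval_len l, eval_snocAux hA ha l, eval_succIso _, hlen⟩

theorem eval_growth {A : Ty} (hA : A.DupClosed) {b : CVal} (hb : A.Dups b) (l r : List CVal) :
    (growth A b.toVal).Eval (.pair (.ofList l) (.ofList r))
      (.pair (.ofList (l ++ [b])) (.ofList (r ++ [b]))) :=
  .of_mem (env [.ofList l, .ofList r, .ofList l, b, .ofList (l ++ [b]), b, .ofList r, b,
      .ofList (r ++ [b]), b, .ofList (l ++ [b]), .ofList (r ++ [b])])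
    (.head _ _ _) rfl rfl
    ⟨(eval_erase b _).inv, eval_snoc hA hb l, (eval_erase b _).inv, eval_snoc hA hb r,
      eval_erase b _, eval_erase b _⟩

theorem eval_revAux {A : Ty} (hA : A.DupClosed) (l k : List CVal) (hl : ∀ a ∈ l, A.Dups a) :
    (revAux A).Eval (.pair (.ofList l) (.ofList k))
      (.pair (.ofList l) (.ofList (l.reverse ++ k))) := by
  induction l generalizing k with
  | nil => exact .step (.fix _) (.of_mem (env [.ofList k]) (.head _ _ _) rfl rfl trivial)
  | cons x l ih =>
    have hx := hl x (by simp)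
    rw [Ty.Dups, ← hA] at hx
    have ih := ih (x :: k) fun b hb => hl b (by simp [hb])
    refine .step (.fix _) (.of_mem (env [x, .ofList l, .ofList k, x, x, .ofList (x :: k),
        .ofList l, .ofList (l.reverse ++ x :: k)])
      (.tail _ _ _ _ _ (.head _ _ _)) rfl ?_ ⟨hx, eval_consIso x (.ofList k), ih⟩)
    rw [List.reverse_cons, List.append_assoc]
    rfl

theorem eval_rev {A : Ty} (hA : A.DupClosed) (l : List CVal) (hl : ∀ a ∈ l, A.Dups a) :
    (rev A).Eval (.ofList l) (.pair (.ofList l) (.ofList l.reverse)) := by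
  have h := eval_revAux hA l [] hl
  rw [List.append_nil] at h
  exact .of_mem (env [.ofList l, .ofList l, .nil, .ofList l, .ofList l.reverse])
    (.head _ _ _) rfl rfl ⟨(eval_erase .nil _).inv, h⟩

/-- Removing the blanks `b` in front of a list that is empty or starts with another symbol. -/
theorem eval_rmBlank (b : CVal) (as : List Val) (k : ℕ) (l : List CVal)
    (hl : ∀ a ∈ l.head?, a.toVal ∈ as) :
    (rmBlank b.toVal as).Eval (.ofList (List.replicate k b ++ l))
      (.pair (.ofList l) (.nat k)) := by
  induction k with
  | zero =>
    cases l with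
    | nil => exact .step (.fix _) (.of_mem (env []) (.head _ _ _) rfl rfl trivial)
    | cons a l =>
      have hm : (a.toVal.cons (.var 0), Expr.val (.pair (a.toVal.cons (.var 0)) .zero)) ∈
          as.map fun a => (a.cons (.var 0), Expr.val (.pair (a.cons (.var 0)) .zero)) :=
        List.mem_map.2 ⟨a.toVal, hl a (by simp), rfl⟩
      refine .step (.fix _) (.of_mem (env [.ofList l]) (.tail _ _ _ _ _ (.tail _ _ _ _ _
        ((Clauses.mem_ofList hm).subst _ _))) ?_ ?_ trivial)
      · simp [Val.eval, Val.cons, env, CVal.ofList, CVal.cons]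
      · simp [Expr.subst, Expr.result, Val.eval, Val.cons, Val.zero, env, CVal.ofList, CVal.cons,
          CVal.nat, CVal.zero]
  | succ k ih =>
    refine .step (.fix _) (.of_mem (env [.ofList (List.replicate k b ++ l), .ofList l, .nat k])
      (.tail _ _ _ _ _ (.head _ _ _)) ?_ rfl ih)
    simp [Val.eval, Val.cons, env, CVal.ofList, CVal.cons, List.replicate_succ]

/-! ### Iteration, composition and garbage removal -/

/-- The recursive iso that `It ψ` evaluates to. -/
def itLoop (ψ : Iso) : Iso := .fix <| .ofList [
  (.var 0,
    .letIn (.var 1) (ψ.shift 0) (.var 0) <|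
    .letIn (.var 2) (.app itAux (.var 0)) (.var 1) <|
    .val (.var 2))]

theorem itLoop_stop {ψ : Iso} {x y : CVal} (h : ψ.Eval x (.pair y .ff)) :
    (itLoop ψ).Eval x (.pair y (.nat 0)) := by
  rw [← Iso.subst_shift 0 (itLoop ψ) ψ] at h
  refine .step (.fix _) (.of_mem (env [x, .pair y .ff, .pair y .zero]) (.head _ _ _) rfl rfl
    ⟨h, .step (.beta _ _) ?_⟩)
  exact .of_mem (env [y]) (.tail _ _ _ _ _ (.head _ _ _)) rfl rfl trivial

theorem itLoop_continue {ψ : Iso} {x y z : CVal} {n : ℕ} (h : ψ.Eval x (.pair y .tt))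
    (hy : (itLoop ψ).Eval y (.pair z (.nat n))) :
    (itLoop ψ).Eval x (.pair z (.nat (n + 1))) := by
  rw [← Iso.subst_shift 0 (itLoop ψ) ψ] at h
  refine .step (.fix _) (.of_mem (env [x, .pair y .tt, .pair z (.nat (n + 1))]) (.head _ _ _)
    rfl rfl ⟨h, .step (.beta _ _) ?_⟩)
  exact .of_mem (env [y, z, .nat n]) (.head _ _ _) rfl rfl hy

theorem eval_it {ψ : Iso} {x y : CVal} (h : (itLoop ψ).Eval x y) : (Iso.app it ψ).Eval x y :=
  .step (.beta _ _) h

theorem Iso.Eval.andThen {ω₁ ω₂ : Iso} {x y z : CVal} (h₁ : ω₁.Eval x y) (h₂ : ω₂.Eval y z) :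
    (ω₁.andThen ω₂).Eval x z :=
  .of_mem (env [x, y, z]) (.head _ _ _) rfl rfl ⟨h₁, h₂⟩

/-- Garbage removal: the second computation, run backwards, erases the copy of the input together
with its own garbage. -/
theorem eval_garRem {B : Ty} {ω ω' : Iso} {x y g g' : CVal} (hx : B.Dups x) (hy : B.Dups y)
    (h : ω.Eval x (.pair y g)) (h' : ω'.Eval y (.pair x g')) : (garRem B ω ω').Eval x y :=
  .of_mem (env [x, y, g, y, y, x, x, g', x, y]) (.head _ _ _) rfl rfl
    ⟨h, hy, h.inv, h', hx.inv, h'.inv⟩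

/-! ### Well-scopedness of the isos -/

theorem Iso.wf_ofList {cs : List (Val × Expr)}
    (h : ∀ c ∈ cs, BiScoped c.1 c.2.skel c.2.result ∧ c.2.WF) : (Iso.ofList cs).WF := by
  rw [Iso.ofList, Iso.WF]
  induction cs with
  | nil => simp only [Clauses.ofList, Clauses.WF]
  | cons c cs ih =>
    obtain ⟨h₁, h₂⟩ := h c (by simp)
    simp only [Clauses.ofList, Clauses.WF]
    exact ⟨h₁, h₂, ih fun d hd => h d (by simp [hd])⟩

theorem wf_dup (A : Ty) : (dup A).WF := by
  induction A with
  | _ => simp_all [dup, Iso.ofList, Clauses.ofList, Iso.WF, Clauses.WF, Expr.WF, Expr.skel,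
      Expr.result, BiScoped, Scoped, Val.vars, Pat.vars]

theorem wf_erase (v : CVal) : (erase v.toVal).WF := by
  simp [erase, Iso.ofList, Clauses.ofList, Iso.WF, Clauses.WF, Expr.WF, Expr.skel,
      Expr.result, BiScoped, Scoped, Val.vars]

theorem wf_erase_nil : (erase .nil).WF := wf_erase .nil

theorem wf_len : len.WF := by
  simp [len, Iso.ofList, Clauses.ofList, Iso.WF, Clauses.WF, Expr.WF, Expr.skel, Val.nil,
    Val.cons, Val.zero, Val.succ, Expr.result, BiScoped, Scoped, Val.vars, Pat.vars]

theorem wf_snocAux (A : Ty) : (snocAux A).WF := by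
  simp [snocAux, Iso.ofList, Clauses.ofList, Iso.WF, Clauses.WF, Expr.WF, Expr.skel, Val.nil,
    Val.cons, Val.zero, Val.succ, Expr.result, BiScoped, Scoped, Val.vars, Pat.vars, wf_dup]

theorem wf_succIso : succIso.WF := by
  simp [succIso, Iso.ofList, Clauses.ofList, Iso.WF, Clauses.WF, Expr.WF, Expr.skel,
    Val.succ, Expr.result, BiScoped, Scoped, Val.vars]

theorem wf_consIso : consIso.WF := by
  simp [consIso, Iso.ofList, Clauses.ofList, Iso.WF, Clauses.WF, Expr.WF, Expr.skel,
    Val.cons, Expr.result, BiScoped, Scoped, Val.vars]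

theorem wf_snoc (A : Ty) : (snoc A).WF := by
  simp [snoc, Iso.ofList, Clauses.ofList, Iso.WF, Clauses.WF, Expr.WF, Expr.skel,
    Expr.result, BiScoped, Scoped, Val.vars, Pat.vars, wf_len, wf_len.inv, wf_snocAux, wf_succIso]

theorem wf_growth (A : Ty) (b : CVal) : (growth A b.toVal).WF := by
  simp [growth, Iso.ofList, Clauses.ofList, Iso.WF, Clauses.WF, Expr.WF, Expr.skel,
    Expr.result, BiScoped, Scoped, Val.vars, Pat.vars, wf_snoc, wf_erase, (wf_erase b).inv]

theorem wf_revAux (A : Ty) : (revAux A).WF := by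
  simp [revAux, Iso.ofList, Clauses.ofList, Iso.WF, Clauses.WF, Expr.WF, Expr.skel, Val.nil,
    Val.cons, Expr.result, BiScoped, Scoped, Val.vars, Pat.vars, wf_dup, wf_consIso]

theorem wf_rev (A : Ty) : (rev A).WF := by
  simp [rev, Iso.ofList, Clauses.ofList, Iso.WF, Clauses.WF, Expr.WF, Expr.skel,
    Expr.result, BiScoped, Scoped, Val.vars, Pat.vars, wf_revAux, wf_erase_nil.inv]

theorem wf_rmBlank (b : CVal) (as : List CVal) :
    (rmBlank b.toVal (as.map CVal.toVal)).WF := by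
  rw [rmBlank, Iso.WF]
  refine Iso.wf_ofList ?_
  simp [Iso.WF, Expr.WF, Expr.skel, Val.nil, Val.zero, Val.succ,
    Val.cons, Expr.result, BiScoped, Scoped, Val.vars, Pat.vars]

theorem wf_it : it.WF := by
  simp [it, itAux, Iso.ofList, Clauses.ofList, Iso.WF, Clauses.WF, Expr.WF, Expr.skel, Val.zero,
    Val.succ, Val.tt, Val.ff, Expr.result, BiScoped, Scoped, Val.vars, Pat.vars]

theorem Iso.WF.andThen {ω₁ ω₂ : Iso} (h₁ : ω₁.WF) (h₂ : ω₂.WF) : (ω₁.andThen ω₂).WF := by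
  simp [Iso.andThen, Iso.ofList, Clauses.ofList, Iso.WF, Clauses.WF, Expr.WF, Expr.skel,
    Expr.result, BiScoped, Scoped, Val.vars, Pat.vars, h₁, h₂]

theorem wf_garRem (B : Ty) {ω ω' : Iso} (h : ω.WF) (h' : ω'.WF) : (garRem B ω ω').WF := by
  simp [garRem, Iso.ofList, Clauses.ofList, Iso.WF, Clauses.WF, Expr.WF, Expr.skel, wf_dup,
    Expr.result, BiScoped, Scoped, Val.vars, Pat.vars, h, h', h.inv, h'.inv, (wf_dup B).inv]

/-! ### Simulation of one machine step -/

section Machine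

variable {Q Γ : Type*} {n m : ℕ}

theorem Config.BlankEquiv.symm {b : Γ} {C D : Config Q Γ} (h : C.BlankEquiv b D) :
    D.BlankEquiv b C := by
  obtain ⟨h₁, h₂, ⟨i, j, h₃⟩, ⟨k, l, h₄⟩⟩ := h
  exact ⟨h₁.symm, h₂.symm, ⟨j, i, h₃.symm⟩, ⟨l, k, h₄.symm⟩⟩

theorem Config.BlankEquiv.trans {b : Γ} {C D E : Config Q Γ} (h : C.BlankEquiv b D)
    (h' : D.BlankEquiv b E) : C.BlankEquiv b E := by
  obtain ⟨h₁, h₂, ⟨i, j, h₃⟩, ⟨k, l, h₄⟩⟩ := h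
  obtain ⟨h₁', h₂', ⟨i', j', h₃'⟩, ⟨k', l', h₄'⟩⟩ := h'
  refine ⟨h₁.trans h₁', h₂.trans h₂', ⟨i' + i, j + j', ?_⟩, ⟨k + k', l' + l, ?_⟩⟩
  · rw [List.replicate_add, List.append_assoc, h₃, ← List.append_assoc, ← List.replicate_add,
      Nat.add_comm i' j, List.replicate_add, List.append_assoc, h₃', ← List.append_assoc,
      ← List.replicate_add]
  · rw [List.replicate_add, ← List.append_assoc, h₄, List.append_assoc, ← List.replicate_add,
      Nat.add_comm l k', List.replicate_add, ← List.append_assoc, h₄', List.append_assoc,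
      ← List.replicate_add]

/-- The same configuration, written with one more blank at either end of the tape. -/
def Config.grow (b : Γ) (C : Config Q Γ) : Config Q Γ :=
  ⟨C.state, b :: C.left, C.head, C.right ++ [b]⟩

theorem Config.blankEquiv_refl (b : Γ) (C : Config Q Γ) : C.BlankEquiv b C :=
  ⟨rfl, rfl, ⟨0, 0, rfl⟩, ⟨0, 0, rfl⟩⟩

theorem Config.grow_blankEquiv (b : Γ) (C : Config Q Γ) : (C.grow b).BlankEquiv b C :=
  ⟨rfl, rfl, ⟨0, 1, rfl⟩, ⟨0, 1, by simp [Config.grow]⟩⟩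

/-- No transition of `M` moves the head of `C` off the written part of the tape. -/
def TM.StaysWithin (M : TM Q Γ) (C : Config Q Γ) : Prop :=
  ∀ q, ((C.state, .left, q) ∈ M.δ → C.left ≠ []) ∧ ((C.state, .right, q) ∈ M.δ → C.right ≠ [])

theorem TM.staysWithin_grow (M : TM Q Γ) (C : Config Q Γ) (b : Γ) : M.StaysWithin (C.grow b) :=
  fun _ => ⟨fun _ => List.cons_ne_nil _ _, fun _ => by simp [Config.grow]⟩

/-- A step between some representatives of two configurations can be made from every
representative that is long enough. -/
theorem TM.Step.rawStep {M : TM Q Γ} {C C' E : Config Q Γ} (h : M.Step C C')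
    (hE : E.BlankEquiv M.blank C) (hw : M.StaysWithin E) :
    ∃ E', M.RawStep E E' ∧ E'.BlankEquiv M.blank C' := by
  obtain ⟨D, D', hD, hs, hD'⟩ := h
  have hED := hE.trans hD
  suffices ∃ E', M.RawStep E E' ∧ E'.BlankEquiv M.blank D' by
    obtain ⟨E', h₁, h₂⟩ := this
    exact ⟨E', h₁, h₂.trans hD'⟩
  clear hE hD hD'
  obtain ⟨qE, lE, sE, rE⟩ := E
  obtain ⟨h₁, h₂, ⟨i, j, h₃⟩, ⟨k, o, h₄⟩⟩ := hED
  cases hs with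
  | @write q q' s s' l r ht =>
    obtain rfl : qE = q := h₁
    obtain rfl : sE = s := h₂
    exact ⟨_, .write _ _ ht, rfl, rfl, ⟨i, j, h₃⟩, ⟨k, o, h₄⟩⟩
  | @stay q q' l s r ht =>
    obtain rfl : qE = q := h₁
    obtain rfl : sE = s := h₂
    exact ⟨_, .stay _ _ _ ht, rfl, rfl, ⟨i, j, h₃⟩, ⟨k, o, h₄⟩⟩
  | @left q q' l x s r ht =>
    obtain rfl : qE = q := h₁
    obtain rfl : sE = s := h₂
    obtain ⟨l', y, rfl⟩ := (List.eq_nil_or_concat' lE).resolve_left ((hw _).1 ht)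
    simp only [← List.append_assoc] at h₃
    obtain ⟨hl, hy⟩ := List.append_inj' h₃ rfl
    obtain rfl : y = x := by simpa using hy
    exact ⟨_, .left _ _ _ _ ht, rfl, rfl, ⟨i, j, hl⟩, ⟨k, o, by simpa using h₄⟩⟩
  | @right q q' l s x r ht =>
    obtain rfl : qE = q := h₁
    obtain rfl : sE = s := h₂
    obtain ⟨y, r', rfl⟩ := List.exists_cons_of_ne_nil ((hw _).2 ht)
    simp only [List.cons_append, List.cons.injEq] at h₄
    obtain ⟨rfl, h₄⟩ := h₄
    exact ⟨_, .right _ _ _ _ ht, rfl, rfl,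
      ⟨i, j, by simp only [← List.append_assoc] at h₃ ⊢; rw [h₃]⟩, ⟨k, o, h₄⟩⟩

/-- The closed value encoding an element of an enumerated set. -/
def cenc {α : Type*} {k : ℕ} (e : α ≃ Fin k) (a : α) : CVal := .fin k (e a)

theorem enc_eq {α : Type*} {k : ℕ} (e : α ≃ Fin k) (a : α) : enc e a = (cenc e a).toVal :=
  (CVal.toVal_fin _ _).symm

/-- The configuration `C` as a closed value. -/
def cconf (eQ : Q ≃ Fin n) (eΓ : Γ ≃ Fin m) (C : Config Q Γ) : CVal :=
  .pair (cenc eQ C.state) (.pair (.ofList (C.left.reverse.map (cenc eΓ)))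
    (.pair (cenc eΓ C.head) (.ofList (C.right.map (cenc eΓ)))))

theorem toVal_cconf (eQ : Q ≃ Fin n) (eΓ : Γ ≃ Fin m) (C : Config Q Γ) :
    (cconf eQ eΓ C).toVal = isosConf eQ eΓ C := by
  simp [cconf, isosConf, CVal.toVal, CVal.toVal_ofList, funext (enc_eq eΓ), enc_eq eQ,
    Function.comp_def]

theorem dups_cconf (eQ : Q ≃ Fin n) (eΓ : Γ ≃ Fin m) (C : Config Q Γ) :
    (confTy n m).Dups (cconf eQ eΓ C) := by
  have hl : ∀ l : List Γ, (Ty.list (Ty.fin m)).Dups (.ofList (l.map (cenc eΓ))) := fun l =>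
    Ty.dups_list (Ty.dupClosed_fin m) _ fun a ha => by
      obtain ⟨x, _, rfl⟩ := List.mem_map.1 ha
      exact Ty.dups_fin m _
  exact (Ty.dups_fin n _).prod ((hl _).prod ((Ty.dups_fin m _).prod (hl _)))

theorem eval_growth_map (eΓ : Γ ≃ Fin m) (b : Γ) (l r : List Γ) :
    (growth (Ty.fin m) (enc eΓ b)).Eval
      (.pair (.ofList (l.map (cenc eΓ))) (.ofList (r.map (cenc eΓ))))
      (.pair (.ofList ((l ++ [b]).map (cenc eΓ))) (.ofList ((r ++ [b]).map (cenc eΓ)))) := by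
  rw [enc_eq, List.map_append, List.map_append]
  exact eval_growth (Ty.dupClosed_fin m) (Ty.dups_fin m _) _ _

open Classical in
/-- One pass through `isos_𝔹(M)` makes a step of `M` and then grows both ends of the tape. -/
theorem eval_isosB (eQ : Q ≃ Fin n) (eΓ : Γ ≃ Fin m) {M : TM Q Γ} {C C' : Config Q Γ}
    (h : M.RawStep C C') :
    (isosB eQ eΓ M).Eval (cconf eQ eΓ C) (.pair (cconf eQ eΓ (C'.grow M.blank))
      (if C'.state = M.final then .ff else .tt)) := by
  have hmem : ∀ {t}, t ∈ M.δ → (Clauses.ofList (M.δ.toList.map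
      (transClause eQ eΓ M.blank M.final))).Mem (transClause eQ eΓ M.blank M.final t).1
        (transClause eQ eΓ M.blank M.final t).2 := fun ht =>
    Clauses.mem_ofList (List.mem_map_of_mem (Finset.mem_toList.2 ht))
  have hflag : ∀ (q : Q) (ρ : ℕ → CVal), (if q = M.final then Val.ff else Val.tt).eval ρ =
      if q = M.final then CVal.ff else CVal.tt := by
    intro q ρ; split <;> rfl
  -- the values of the variables `0`, …, `5` of the clause; `3` is missing unless the head moves
  have key : ∀ (l : List Γ) (z : Γ) (r : List Γ) (y : CVal) (t : Q × Action Γ × Q), t ∈ M.δ →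
      ∀ ρ, ρ = env [.ofList (l.map (cenc eΓ)), cenc eΓ z, .ofList (r.map (cenc eΓ)), y,
        .ofList ((l ++ [M.blank]).map (cenc eΓ)), .ofList ((r ++ [M.blank]).map (cenc eΓ))] →
      (isosB eQ eΓ M).Eval ((transLhs eQ eΓ t.1 t.2.1).eval ρ)
        (.pair ((transRhs eQ eΓ t.2.2 t.2.1).eval ρ)
          (if t.2.2 = M.final then .ff else .tt)) := by
    rintro l z r y t ht ρ rfl
    refine .of_mem _ (hmem ht) rfl ?_ (eval_growth_map eΓ M.blank l r)
    simp [transClause, Expr.result, Val.eval, hflag]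
  cases h with
  | @write q q' s s' l r ht =>
    have := key l.reverse s r .unit _ ht _ rfl
    simpa [transLhs, transRhs, Val.eval, env, enc_eq, cconf, Config.grow] using this
  | @stay q q' l s r ht =>
    have := key l.reverse s r .unit _ ht _ rfl
    simpa [transLhs, transRhs, Val.eval, env, enc_eq, cconf, Config.grow] using this
  | @left q q' l x s r ht =>
    have := key l.reverse s r (cenc eΓ x) _ ht _ rfl
    simpa [transLhs, transRhs, Val.eval, Val.cons, env, enc_eq, cconf, Config.grow, CVal.ofList,
      CVal.cons] using this
  | @right q q' l s x r ht =>
    have := key l.reverse s r (cenc eΓ x) _ ht _ rfl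
    simpa [transLhs, transRhs, Val.eval, Val.cons, env, enc_eq, cconf, Config.grow, CVal.ofList,
      CVal.cons] using this

/-! ### Simulation of complete runs -/

theorem TM.Step.state_ne_final {M : TM Q Γ} {C C' : Config Q Γ} (h : M.Step C C') :
    C.state ≠ M.final := by
  obtain ⟨D, D', hD, hs, -⟩ := h
  rw [hD.1]
  cases hs with
  | write l r ht => exact M.not_from_final _ _ _ ht
  | left l x s r ht => exact M.not_from_final _ _ _ ht
  | stay l s r ht => exact M.not_from_final _ _ _ ht
  | right l s x r ht => exact M.not_from_final _ _ _ ht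

/-- Iterating `isos_𝔹(M)` follows a run to the final state; the tape grows in each step, so that
only the first step can leave the written part of the tape. -/
theorem eval_itLoop (eQ : Q ≃ Fin n) (eΓ : Γ ≃ Fin m) {M : TM Q Γ} {C C' : Config Q Γ}
    (h : M.Reaches C C') (hC' : C'.state = M.final) :
    C.state ≠ M.final → ∀ E : Config Q Γ, E.BlankEquiv M.blank C → M.StaysWithin E →
      ∃ (F : Config Q Γ) (k : ℕ), F.BlankEquiv M.blank C' ∧
        (itLoop (isosB eQ eΓ M)).Eval (cconf eQ eΓ E) (.pair (cconf eQ eΓ F) (.nat k)) := by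
  induction h using Relation.ReflTransGen.head_induction_on with
  | refl => exact fun hC => absurd hC' hC
  | @head C C₁ hs hr ih =>
    intro _ E hE hw
    obtain ⟨E', hraw, hE'⟩ := hs.rawStep hE hw
    have hev := eval_isosB eQ eΓ hraw
    have hg := (Config.grow_blankEquiv M.blank E').trans hE'
    by_cases hf : C₁.state = M.final
    · rw [if_pos (hE'.1.trans hf)] at hev
      have hC₁ : C₁ = C' := by
        rcases Relation.ReflTransGen.cases_head hr with h | ⟨_, h, _⟩
        · exact h
        · exact absurd hf h.state_ne_final
      exact ⟨_, 0, hC₁ ▸ hg, itLoop_stop hev⟩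
    · rw [if_neg (hE'.1.trans_ne hf)] at hev
      obtain ⟨F, k, hF, hk⟩ := ih hf _ hg (M.staysWithin_grow _ _)
      exact ⟨F, k + 1, hF, itLoop_continue hev hk⟩

theorem eval_rmBlankTape (eΓ : Γ ≃ Fin m) (b : Γ) (k : ℕ) (l : List Γ)
    (hl : b ∉ l) : (rmBlankTape eΓ b).Eval (.ofList ((List.replicate k b ++ l).map (cenc eΓ)))
      (.pair (.ofList (l.map (cenc eΓ))) (.nat k)) := by
  rw [rmBlankTape, enc_eq, List.map_append, List.map_replicate]
  refine eval_rmBlank _ _ k _ fun a ha => ?_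
  cases l with
  | nil => simp at ha
  | cons x l =>
    obtain rfl : cenc eΓ x = a := by simpa using ha
    have hx : x ≠ b := fun h => hl (by simp [h])
    have hx : ∃ i : Fin m, i ≠ eΓ b ∧ (eΓ x : ℕ) = i := ⟨eΓ x, by simpa using hx, rfl⟩
    exact List.mem_map.2 ⟨eΓ x, by simpa using hx, (CVal.toVal_fin _ _).symm⟩

theorem eval_rev_map (eΓ : Γ ≃ Fin m) (l : List Γ) : (rev (Ty.fin m)).Eval
    (.ofList (l.map (cenc eΓ)))
      (.pair (.ofList (l.map (cenc eΓ))) (.ofList (l.reverse.map (cenc eΓ)))) := by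
  rw [List.map_reverse]
  refine eval_rev (Ty.dupClosed_fin m) _ fun a ha => ?_
  obtain ⟨x, _, rfl⟩ := List.mem_map.1 ha
  exact Ty.dups_fin m _

/-- The representatives of a configuration whose tape is a string without blanks to the right of
the head. -/
theorem Config.BlankEquiv.standard {b y : Γ} {q : Q} {s : List Γ} {F : Config Q Γ}
    (h : F.BlankEquiv b ⟨q, [], y, s⟩) (hs : b ∉ s) :
    ∃ i j, F = ⟨q, List.replicate i b, y, s ++ List.replicate j b⟩ := by
  obtain ⟨qF, l, z, r⟩ := F
  obtain ⟨rfl, rfl, ⟨i, j, h₁⟩, ⟨k, o, h₂⟩⟩ := h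
  simp only [List.append_nil] at h₁ h₂
  have hl : l = List.replicate l.length b := by
    refine List.eq_replicate_iff.2 ⟨rfl, fun x hx => ?_⟩
    have : x ∈ List.replicate j b := h₁ ▸ List.mem_append_right _ hx
    exact List.eq_of_mem_replicate this
  have hr : ∃ a, r = s ++ a ∧ a ++ List.replicate k b = List.replicate o b := by
    rcases List.append_eq_append_iff.1 h₂ with ⟨a, h₃, h₄⟩ | ⟨a, h₃, h₄⟩
    · -- the rest of `s` beyond `r` consists of blanks
      cases a with
      | nil => exact ⟨[], by simpa using h₃.symm, by simpa using h₄⟩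
      | cons x a =>
        have hx : x ∈ List.replicate k b := h₄ ▸ by simp
        have : x ∈ s := h₃ ▸ by simp
        exact absurd (List.eq_of_mem_replicate hx ▸ this) hs
    · exact ⟨a, h₃, h₄.symm⟩
  obtain ⟨a, rfl, ha⟩ := hr
  have ha : a = List.replicate a.length b := by
    refine List.eq_replicate_iff.2 ⟨rfl, fun x hx => ?_⟩
    exact List.eq_of_mem_replicate (ha ▸ List.mem_append_left _ hx : x ∈ List.replicate o b)
  exact ⟨l.length, a.length, by rw [← hl, ← ha]⟩

theorem eval_cleanUp (eQ : Q ≃ Fin n) (eΓ : Γ ≃ Fin m) {b : Γ} {q : Q} {s : List Γ}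
    {F : Config Q Γ} (h : F.BlankEquiv b (Config.standard b q s)) (hs : b ∉ s) (k : CVal) :
    ∃ g, (cleanUp eΓ b).Eval (.pair (cconf eQ eΓ F) k)
      (.pair (cconf eQ eΓ (Config.standard b q s)) g) := by
  obtain ⟨i, j, rfl⟩ := Config.BlankEquiv.standard h hs
  have h₁ := eval_rmBlankTape eΓ b i [] (by simp)
  rw [List.append_nil] at h₁
  have h₂ := eval_rev_map eΓ (s ++ List.replicate j b)
  have h₃ := eval_rmBlankTape eΓ b j s.reverse (by simpa using hs)
  rw [List.reverse_append, List.reverse_replicate] at h₂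
  have h₄ := eval_rev_map eΓ s.reverse
  rw [List.reverse_reverse] at h₄
  refine ⟨_, .of_mem (env [cenc eQ q, .ofList ((List.replicate i b).map (cenc eΓ)), cenc eΓ b,
    .ofList ((s ++ List.replicate j b).map (cenc eΓ)), k, .nil, .nat i,
    .ofList ((s ++ List.replicate j b).map (cenc eΓ)),
    .ofList ((List.replicate j b ++ s.reverse).map (cenc eΓ)),
    .ofList (s.reverse.map (cenc eΓ)), .nat j, .ofList (s.reverse.map (cenc eΓ)),
    .ofList (s.map (cenc eΓ))]) (.head _ _ _) ?_ rfl ⟨h₁, h₂, h₃, h₄⟩⟩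
  simp [Val.eval, env, cconf]

theorem eval_run (eQ : Q ≃ Fin n) (eΓ : Γ ≃ Fin m) {M : TM Q Γ} (hne : M.start ≠ M.final)
    {s s' : List Γ} (hs' : M.blank ∉ s')
    (h : M.Reaches (Config.standard M.blank M.start s) (Config.standard M.blank M.final s'))
    {E : Config Q Γ} (hE : E.BlankEquiv M.blank (Config.standard M.blank M.start s))
    (hw : M.StaysWithin E) :
    ∃ g, (run eQ eΓ M).Eval (cconf eQ eΓ E)
      (.pair (cconf eQ eΓ (Config.standard M.blank M.final s')) g) := by
  obtain ⟨F, k, hF, hev⟩ := eval_itLoop eQ eΓ h rfl hne E hE hw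
  obtain ⟨g, hg⟩ := eval_cleanUp eQ eΓ hF hs' (.nat k)
  exact ⟨g, (eval_it hev).andThen hg⟩

theorem eval_pad (eQ : Q ≃ Fin n) (eΓ : Γ ≃ Fin m) (b : Γ) (C : Config Q Γ) :
    (pad eΓ b).Eval (cconf eQ eΓ C) (cconf eQ eΓ (C.grow b)) := by
  refine .of_mem (env [cenc eQ C.state, .ofList (C.left.reverse.map (cenc eΓ)), cenc eΓ C.head,
    .ofList (C.right.map (cenc eΓ)), .ofList ((C.left.reverse ++ [b]).map (cenc eΓ)),
    .ofList ((C.right ++ [b]).map (cenc eΓ))]) (.head _ _ _) rfl ?_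
    (eval_growth_map eΓ b C.left.reverse C.right)
  simp [Expr.result, Val.eval, env, cconf, Config.grow]

theorem eval_paddedRun (eQ : Q ≃ Fin n) (eΓ : Γ ≃ Fin m) {M : TM Q Γ} (hne : M.start ≠ M.final)
    {s s' : List Γ} (hs' : M.blank ∉ s')
    (h : M.Reaches (Config.standard M.blank M.start s) (Config.standard M.blank M.final s')) :
    ∃ g, (paddedRun eQ eΓ M).Eval (cconf eQ eΓ (Config.standard M.blank M.start s))
      (.pair (cconf eQ eΓ (Config.standard M.blank M.final s')) g) := by
  obtain ⟨g, hg⟩ := eval_run eQ eΓ hne hs' h (Config.grow_blankEquiv M.blank _)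
    (M.staysWithin_grow _ _)
  exact ⟨g, (eval_pad eQ eΓ M.blank _).andThen hg⟩

theorem TM.StartsWithin.staysWithin {M : TM Q Γ} {s : List Γ} (h : M.StartsWithin s) :
    M.StaysWithin (Config.standard M.blank M.start s) :=
  fun q => ⟨fun hq => absurd hq (h q).1, (h q).2⟩

/-! ### The inverse machine -/

theorem TM.mem_inv {M : TM Q Γ} {q q' : Q} {a : Action Γ} (h : (q, a, q') ∈ M.δ) :
    (q', a.inv, q) ∈ M.inv.δ :=
  Finset.mem_map.2 ⟨_, h, rfl⟩

theorem TM.RawStep.inv {M : TM Q Γ} {C C' : Config Q Γ} (h : M.RawStep C C') :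
    M.inv.RawStep C' C := by
  cases h with
  | write l r ht => exact .write _ _ (TM.mem_inv ht)
  | left l x s r ht => exact .right _ _ _ _ (TM.mem_inv ht)
  | stay l s r ht => exact .stay _ _ _ (TM.mem_inv ht)
  | right l s x r ht => exact .left _ _ _ _ (TM.mem_inv ht)

theorem TM.Reaches.inv {M : TM Q Γ} {C C' : Config Q Γ} (h : M.Reaches C C') :
    M.inv.Reaches C' C := by
  induction h with
  | refl => exact .refl
  | tail _ hs ih =>
    obtain ⟨D, D', h₁, h₂, h₃⟩ := hs
    exact .head ⟨D', D, h₃.symm, h₂.inv, h₁.symm⟩ ih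

/-! ### Well-scopedness of the encoded machine -/

theorem wf_growth_enc (eΓ : Γ ≃ Fin m) (b : Γ) : (growth (Ty.fin m) (enc eΓ b)).WF :=
  enc_eq eΓ b ▸ wf_growth _ _

open Classical in
theorem wf_isosB (eQ : Q ≃ Fin n) (eΓ : Γ ≃ Fin m) (M : TM Q Γ) : (isosB eQ eΓ M).WF := by
  refine Iso.wf_ofList fun c hc => ?_
  obtain ⟨⟨q, a, q'⟩, _, rfl⟩ := List.mem_map.1 hc
  have hf : (if q' = M.final then Val.ff else Val.tt).vars = [] := by split <;> rfl
  cases a <;>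
    simp [transClause, transLhs, transRhs, Expr.WF, Expr.skel, Expr.result, BiScoped, Scoped,
      Val.vars, Pat.vars, Val.cons, enc_eq, hf, wf_growth]

theorem wf_rmBlankTape (eΓ : Γ ≃ Fin m) (b : Γ) : (rmBlankTape eΓ b).WF := by
  have := wf_rmBlank (cenc eΓ b)
    (((List.finRange m).filter (· ≠ eΓ b)).map fun i => CVal.fin m i)
  simpa only [rmBlankTape, enc_eq, List.map_map, Function.comp_def, CVal.toVal_fin] using this

theorem wf_cleanUp (eΓ : Γ ≃ Fin m) (b : Γ) : (cleanUp eΓ b).WF := by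
  simp [cleanUp, Iso.ofList, Clauses.ofList, Iso.WF, Clauses.WF, Expr.WF, Expr.skel, Expr.result,
    BiScoped, Scoped, Val.vars, Pat.vars, wf_rmBlankTape, wf_rev]

theorem wf_pad (eΓ : Γ ≃ Fin m) (b : Γ) : (pad eΓ b).WF := by
  simp [pad, Iso.ofList, Clauses.ofList, Iso.WF, Clauses.WF, Expr.WF, Expr.skel, Expr.result,
    BiScoped, Scoped, Val.vars, Pat.vars, wf_growth_enc]

theorem wf_run (eQ : Q ≃ Fin n) (eΓ : Γ ≃ Fin m) (M : TM Q Γ) : (run eQ eΓ M).WF :=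
  .andThen (by rw [Iso.WF]; exact ⟨wf_it, wf_isosB eQ eΓ M⟩) (wf_cleanUp eΓ _)

theorem wf_paddedRun (eQ : Q ≃ Fin n) (eΓ : Γ ≃ Fin m) (M : TM Q Γ) : (paddedRun eQ eΓ M).WF :=
  (wf_pad eΓ _).andThen (wf_run eQ eΓ M)

theorem reduces_garRem (eQ : Q ≃ Fin n) (eΓ : Γ ≃ Fin m) {ω ω' : Iso} {C C' : Config Q Γ}
    (hω : ω.WF) (hω' : ω'.WF)
    (h : ∃ g, ω.Eval (cconf eQ eΓ C) (.pair (cconf eQ eΓ C') g))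
    (h' : ∃ g, ω'.Eval (cconf eQ eΓ C') (.pair (cconf eQ eΓ C) g)) :
    Term.Reduces (.app (garRem (confTy n m) ω ω') (isosConf eQ eΓ C).toTerm)
      (isosConf eQ eΓ C').toTerm := by
  obtain ⟨g, h⟩ := h
  obtain ⟨g', h'⟩ := h'
  rw [← toVal_cconf, ← toVal_cconf]
  exact (eval_garRem (dups_cconf _ _ _) (dups_cconf _ _ _) h h').reduces (wf_garRem _ hω hω')

end Machine

end RevLang

open RevLang
theorem mainTheorem1 {Q Γ : Type*} {n m : ℕ} (eQ : Q ≃ Fin n) (eΓ : Γ ≃ Fin m)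
    (M : TM Q Γ) (hM : M.Reversible) (hne : M.start ≠ M.final) (s s' : List Γ)
    (hs : M.blank ∉ s) (hs' : M.blank ∉ s')
    (hrun : M.Reaches (Config.standard M.blank M.start s) (Config.standard M.blank M.final s')) :
    -- for every reversible machine, growing the tape once before the iteration starts
    Term.Reduces
      (.app (garRem (confTy n m) (paddedRun eQ eΓ M) (paddedRun eQ eΓ M.inv))
        (isosConf eQ eΓ (Config.standard M.blank M.start s)).toTerm)
      (isosConf eQ eΓ (Config.standard M.blank M.final s')).toTerm ∧
    -- without that, if neither machine leaves its finite initial tape in the first step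
    (M.StartsWithin s → M.inv.StartsWithin s' →
      Term.Reduces
        (.app (garRem (confTy n m) (run eQ eΓ M) (run eQ eΓ M.inv))
          (isosConf eQ eΓ (Config.standard M.blank M.start s)).toTerm)
        (isosConf eQ eΓ (Config.standard M.blank M.final s')).toTerm) := by
  have hinv : M.inv.Reaches (Config.standard M.inv.blank M.inv.start s')
      (Config.standard M.inv.blank M.inv.final s) := hrun.inv
  refine ⟨reduces_garRem eQ eΓ (wf_paddedRun eQ eΓ M) (wf_paddedRun eQ eΓ M.inv)
    (eval_paddedRun eQ eΓ hne hs' hrun)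
    (eval_paddedRun (M := M.inv) eQ eΓ hne.symm hs hinv), fun hw hw' => ?_⟩
  exact reduces_garRem eQ eΓ (wf_run eQ eΓ M) (wf_run eQ eΓ M.inv)
    (eval_run eQ eΓ hne hs' hrun (Config.blankEquiv_refl _ _) hw.staysWithin)
    (eval_run (M := M.inv) eQ eΓ hne.symm hs hinv (Config.blankEquiv_refl _ _) hw'.staysWithin)
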